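/- **Theorem (Giant Component).** Fix reals $0<\mu<1$, $1>\alpha>\beta>\gamma>0$ and $\rho>0$, put $\Theta=\begin{pmatrix}\alpha&\beta\\ \beta&\gamma\end{pmatrix}$ (rows and columns indexed by $0,1$), and for every $n\ge 1$ let $l=l_n\ge 0$ be $\rho\log_2 n$ rounded to a neighbouring integer (down or up, $|l_n-\rho\log_2 n|<1$). Let $M(n,l,\mu,\Theta)$ be the random simple graph on $n$ nodes obtained as follows: each node $u$ has $l$ attributes $a_1(u),\dots,a_l(u)\in\{0,1\}$, all attributes of all nodes are independent, and each equals $0$ with probability $\mu$; given the attributes, each unordered pair $\{u,v\}$ of distinct nodes is joined by an edge independently, with probability $\prod_{i=1}^{l}\Theta[a_i(u),a_i(v)]$. Let $$q=\Big[(\mu\alpha+(1-\mu)\beta)^{\mu}\,(\mu\beta+(1-\mu)\gamma)^{1-\mu}\Big]^{\rho}.$$ Then with high probability as $n\to\infty$ exactly one connected component of size $\Theta(n)$ exists if and only if $q\ge\frac12$. Here the left-hand side means: there is a constant $c>0$ such that for every $\varepsilon>0$, with probability tending to $1$ as $n\to\infty$, some connected component of $M(n,l,\mu,\Theta)$ has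 at least $cn$ nodes and every other connected component has at most $\varepsilon n$ nodes. Moreover, if $q<\frac12$ then with high probability no component has linear size: for every $\varepsilon>0$, with probability tending to $1$, every connected component has at most $\varepsilon n$ nodes. -/

import Mathlib

open Filter Topology

namespace MAG

open scoped Classical in
/-- Probability of the attribute assignment `a` (node `u` has the `l` binary attributes `a u i`)
when all attributes are i.i.d. and each takes the value `0` with probability `μ`. -/
noncomputable def attrWeight (μ : ℝ) {n l : ℕ} (a : Fin n → Fin l → Fin 2) : ℝ :=
  ∏ u, ∏ i, if a u i = 0 then μ else 1 - μ

/-- The edge probability `P[u, v]` given the attributes: the product of the affinities. -/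
noncomputable def edgeProb (Θ : Matrix (Fin 2) (Fin 2) ℝ) {n l : ℕ}
    (a : Fin n → Fin l → Fin 2) (u v : Fin n) : ℝ :=
  ∏ i, Θ (a u i) (a v i)

/-- The unordered pairs of distinct nodes, each written with its smaller node first. -/
abbrev Pair (n : ℕ) : Type := {e : Fin n × Fin n // e.1 < e.2}

open scoped Classical in
/-- Conditional probability of the graph `G` given the attributes: every unordered pair of
distinct nodes is joined independently, with probability `P[u, v]`. -/
noncomputable def graphWeight (Θ : Matrix (Fin 2) (Fin 2) ℝ) {n l : ℕ}
    (a : Fin n → Fin l → Fin 2) (G : SimpleGraph (Fin n)) : ℝ :=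
  ∏ e : Pair n,
    if G.Adj e.1.1 e.1.2 then edgeProb Θ a e.1.1 e.1.2 else 1 - edgeProb Θ a e.1.1 e.1.2

open scoped Classical in
/-- Probability that the random graph `M(n, l, μ, Θ)` lies in the event `E`. -/
noncomputable def prob (n l : ℕ) (μ : ℝ) (Θ : Matrix (Fin 2) (Fin 2) ℝ)
    (E : Set (SimpleGraph (Fin n))) : ℝ :=
  ∑ a : Fin n → Fin l → Fin 2, ∑ G : SimpleGraph (Fin n),
    if G ∈ E then attrWeight μ a * graphWeight Θ a G else 0

/-- With high probability `M(n, l n, μ, Θ)` has exactly one connected component of linear size: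
for some `c > 0` one component has at least `c n` nodes, and all the others have `o(n)` nodes,
with probability tending to one. -/
def UniqueGiantWHP (l : ℕ → ℕ) (μ : ℝ) (Θ : Matrix (Fin 2) (Fin 2) ℝ) : Prop :=
  ∃ c : ℝ, 0 < c ∧ ∀ ε : ℝ, 0 < ε →
    Tendsto (fun n : ℕ => prob n (l n) μ Θ
      {G | ∃ C : G.ConnectedComponent, c * n ≤ (C.supp.ncard : ℝ) ∧
        ∀ C' : G.ConnectedComponent, C' ≠ C → (C'.supp.ncard : ℝ) ≤ ε * n}) atTop (𝓝 1)

/-- With high probability every connected component of `M(n, l n, μ, Θ)` has `o(n)` nodes. -/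
def NoGiantWHP (l : ℕ → ℕ) (μ : ℝ) (Θ : Matrix (Fin 2) (Fin 2) ℝ) : Prop :=
  ∀ ε : ℝ, 0 < ε →
    Tendsto (fun n : ℕ => prob n (l n) μ Θ
      {G | ∀ C : G.ConnectedComponent, (C.supp.ncard : ℝ) ≤ ε * n}) atTop (𝓝 1)

/-- A graph is determined by the set of pairs that it joins, and every set occurs. -/
def graphEquiv (n : ℕ) : SimpleGraph (Fin n) ≃ (Pair n → Prop) where
  toFun G e := G.Adj e.1.1 e.1.2
  invFun f :=
    { Adj := fun u v => (∃ h : u < v, f ⟨(u, v), h⟩) ∨ (∃ h : v < u, f ⟨(v, u), h⟩)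
      symm := ⟨fun _ _ h => h.symm⟩
      loopless := ⟨fun u h => by
        rcases h with ⟨h, _⟩ | ⟨h, _⟩ <;> exact lt_irrefl _ h⟩ }
  left_inv G := by
    ext u v
    constructor
    · rintro (⟨_, h⟩ | ⟨_, h⟩)
      · exact h
      · exact h.symm
    · intro h
      rcases lt_or_gt_of_ne h.ne with h' | h'
      · exact Or.inl ⟨h', h⟩
      · exact Or.inr ⟨h', h.symm⟩
  right_inv f := by
    funext e
    obtain ⟨⟨u, v⟩, h⟩ := e
    apply propext
    constructor
    · rintro (⟨_, h'⟩ | ⟨h', _⟩)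
      · exact h'
      · exact absurd h' (lt_asymm h)
    · intro h'
      exact Or.inl ⟨h, h'⟩

theorem sum_attrWeight (μ : ℝ) (n l : ℕ) :
    ∑ a : Fin n → Fin l → Fin 2, attrWeight μ a = 1 := by
  have h1 : ∑ b : Fin l → Fin 2, ∏ i, (if b i = 0 then μ else 1 - μ) = 1 := by
    rw [← Fintype.prod_sum (fun (_ : Fin l) (x : Fin 2) => if x = 0 then μ else 1 - μ)]
    simp [Fin.sum_univ_two]
  have h2 := Fintype.prod_sum
    (fun (_ : Fin n) (b : Fin l → Fin 2) => ∏ i, (if b i = 0 then μ else 1 - μ))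
  simp only [h1, Finset.prod_const_one] at h2
  rw [h2]
  refine Finset.sum_congr rfl fun a _ => ?_
  unfold attrWeight
  refine Finset.prod_congr rfl fun u _ => Finset.prod_congr rfl fun i _ => ?_
  congr

open scoped Classical in
theorem sum_graphWeight (Θ : Matrix (Fin 2) (Fin 2) ℝ) {n l : ℕ} (a : Fin n → Fin l → Fin 2) :
    ∑ G : SimpleGraph (Fin n), graphWeight Θ a G = 1 := by
  have h := Fintype.prod_sum (fun (e : Pair n) (x : Prop) =>
    if x then edgeProb Θ a e.1.1 e.1.2 else 1 - edgeProb Θ a e.1.1 e.1.2)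
  rw [← (graphEquiv n).sum_comp] at h
  have h0 : ∀ p : ℝ, ∑ x : Prop, (if x then p else 1 - p) = 1 := by
    intro p
    simp
  simp only [h0, Finset.prod_const_one] at h
  rw [h]
  rfl

/-- The weights of all outcomes add up to one. -/
theorem prob_univ (n l : ℕ) (μ : ℝ) (Θ : Matrix (Fin 2) (Fin 2) ℝ) :
    prob n l μ Θ Set.univ = 1 := by
  simp only [prob, Set.mem_univ, if_true, ← Finset.mul_sum, sum_graphWeight, mul_one,
    sum_attrWeight]

end MAG

/-! The expected degree of a node depends only on its own attributes: up to the excluded self-pair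
it is `n * meanAffinity`. With `A = μα + (1-μ)β` and `B = μβ + (1-μ)γ`, the mean affinity has a
factor `A` for each attribute 0 and a factor `B` for each attribute 1. Its logarithm is therefore a
sum of i.i.d. terms with mean `m = μ log A + (1-μ) log B`. Since `l ≈ ρ log₂ n`, the logarithm of
the expected degree is `κ log n` plus fluctuations of order `√(log n)`, where `κ = 1 + ρ m / log 2`;
and `q ≥ 1/2` says exactly that `κ ≥ 0`.

These fluctuations swamp every power of `log n`. By the central limit theorem the proportion of
nodes with expected degree at least `(log n)^k` tends to a limit independent of `k`: it is 1 if `κ >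
0`, a positive Gaussian tail if `κ = 0`, and 0 if `κ < 0` (`tendsto_goodProb_threshold`). Call a
node good if its expected degree is at least `(log n)²`, and bad if it is below `1 / log n`. The
nodes that are neither have vanishing proportion, and by Markov's inequality almost all bad nodes
are isolated (`expect_many_exceptional_le`). For `κ < 0` almost all nodes are bad, so no component
is large.

For `κ ≥ 0` a positive proportion of the nodes is good, and it remains to see that all good nodes
lie in one component (`expect_good_not_connected_le`). Set aside about a third of the nodes. Given
the attributes of the others, the neighbourhoods of the reserved nodes are i.i.d. random hyperedges
(`expect_bipartite`). A reserved node hits each side of a cut of the good nodes with a probability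
that decreases in its attributes, so Harris' inequality bounds the probability of hitting both sides
below by the product of the two (`IsAffinity.cut_le`). One factor is at least `(log n)² / n`, the
other is bounded below. Each hyperedge then shrinks the expected number of classes by a factor `1 -
c (log n)² / n` (`pexp_not_connected_le`), and linearly many of them leave an error `n exp(-c' (log
n)²)`, which tends to 0. -/

namespace MAG

/-! ### Expectations over independent coordinates. -/

section ProductExpectation

variable {ι κ α : Type*} [Fintype ι] [Fintype κ] [Fintype α]

/-- The expectation of `F` when the coordinates `f i` are independent with weights `w i`. -/
noncomputable def pexp [DecidableEq ι] (w : ι → α → ℝ) (F : (ι → α) → ℝ) : ℝ :=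
  ∑ f : ι → α, (∏ i, w i (f i)) * F f

variable [DecidableEq ι] [DecidableEq κ]

theorem pexp_mono {w : ι → α → ℝ} (hw : ∀ i a, 0 ≤ w i a) {F G : (ι → α) → ℝ}
    (h : ∀ f, F f ≤ G f) : pexp w F ≤ pexp w G :=
  Finset.sum_le_sum fun f _ =>
    mul_le_mul_of_nonneg_left (h f) (Finset.prod_nonneg fun i _ => hw i _)

theorem pexp_add (w : ι → α → ℝ) (F G : (ι → α) → ℝ) :
    pexp w (fun f => F f + G f) = pexp w F + pexp w G := by
  simp only [pexp, mul_add, Finset.sum_add_distrib]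

theorem pexp_const_mul (w : ι → α → ℝ) (c : ℝ) (F : (ι → α) → ℝ) :
    pexp w (fun f => c * F f) = c * pexp w F := by
  simp only [pexp, Finset.mul_sum]
  exact Finset.sum_congr rfl fun f _ => by ring

theorem pexp_sum {σ : Type*} (s : Finset σ) (w : ι → α → ℝ) (F : σ → (ι → α) → ℝ) :
    pexp w (fun f => ∑ x ∈ s, F x f) = ∑ x ∈ s, pexp w (F x) := by
  simp only [pexp, Finset.mul_sum]
  exact Finset.sum_comm

theorem pexp_prod (w : ι → α → ℝ) (g : ι → α → ℝ) :
    pexp w (fun f => ∏ i, g i (f i)) = ∏ i, ∑ a, w i a * g i a := by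
  simp only [pexp, ← Finset.prod_mul_distrib]
  exact (Fintype.prod_sum fun i a => w i a * g i a).symm

theorem pexp_const {w : ι → α → ℝ} (hw : ∀ i, ∑ a, w i a = 1) (c : ℝ) :
    pexp w (fun _ => c) = c := by
  have h := Fintype.prod_sum w
  simp only [hw, Finset.prod_const_one] at h
  rw [pexp, ← Finset.sum_mul, ← h, one_mul]

theorem pexp_equiv (e : κ ≃ ι) (w : ι → α → ℝ) (F : (κ → α) → ℝ) :
    pexp w (fun f => F (fun k => f (e k))) = pexp (fun k => w (e k)) F := by
  unfold pexp
  refine Fintype.sum_equiv (e.arrowCongr (Equiv.refl α)).symm _ _ fun f => ?_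
  congr 1
  exact (e.prod_comp fun i => w i (f i)).symm

theorem pexp_sumElim (w : ι ⊕ κ → α → ℝ) (F : (ι ⊕ κ → α) → ℝ) :
    pexp w F = pexp (fun i => w (Sum.inl i))
      (fun f => pexp (fun k => w (Sum.inr k)) fun g => F (Sum.elim f g)) := by
  unfold pexp
  rw [← (Equiv.sumArrowEquivProdArrow ι κ α).symm.sum_comp, Fintype.sum_prod_type]
  refine Finset.sum_congr rfl fun f _ => ?_
  rw [Finset.mul_sum]
  refine Finset.sum_congr rfl fun g _ => ?_
  rw [Fintype.prod_sum_type, mul_assoc]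
  rfl

/-- Coordinates on which `F` does not depend can be summed out. -/
theorem pexp_comp_injective {j : κ → ι} (hj : Function.Injective j) {w : ι → α → ℝ}
    (hw : ∀ i, ∑ a, w i a = 1) (F : (κ → α) → ℝ) :
    pexp w (fun f => F (fun k => f (j k))) = pexp (fun k => w (j k)) F := by
  classical
  let e : κ ⊕ ((Set.range j)ᶜ : Set ι) ≃ ι :=
    ((Equiv.ofInjective j hj).sumCongr (Equiv.refl _)).trans (Equiv.Set.sumCompl (Set.range j))
  have he : ∀ k, e (Sum.inl k) = j k := fun k => by simp [e]
  have h1 := pexp_equiv e w (fun f => F (fun k => f (Sum.inl k)))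
  simp only [he] at h1
  rw [h1, pexp_sumElim]
  simp only [Sum.elim_inl, he]
  refine congrArg _ (funext fun f => ?_)
  exact pexp_const (fun i => hw _) _

theorem pexp_curry (w : ι × κ → α → ℝ) (F : (ι → κ → α) → ℝ) :
    pexp w (fun f => F (fun i k => f (i, k))) =
      ∑ T : ι → κ → α, (∏ i, ∏ k, w (i, k) (T i k)) * F T := by
  unfold pexp
  refine Fintype.sum_equiv (Equiv.curry ι κ α) _ _ fun f => ?_
  rw [Fintype.prod_prod_type]
  rfl

end ProductExpectation

/-! ### Connectivity of random hypergraphs by a drift argument. -/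

section Drift

variable {V : Type*} [Fintype V]

/-- The finest equivalence relation that identifies all elements of `N`. -/
def mergeSetoid (N : Set V) : Setoid V where
  r u v := u = v ∨ (u ∈ N ∧ v ∈ N)
  iseqv := ⟨fun _ => Or.inl rfl, fun h => h.elim (fun h => Or.inl h.symm) fun h => Or.inr h.symm,
    fun {x y z} h1 h2 => by
      rcases h1 with rfl | h1
      · exact h2
      · rcases h2 with rfl | h2
        · exact Or.inr h1
        · exact Or.inr ⟨h1.1, h2.2⟩⟩

open scoped Classical in
-- All classes that meet `N` collapse into a single one, so the class of one point of `N` together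
-- with the classes missing `N` already maps onto the new quotient.
theorem card_quotient_sup_mergeSetoid (s : Setoid V) (N : Set V) (hN : N.Nonempty) :
    Fintype.card (Quotient (s ⊔ mergeSetoid N)) +
      (Finset.univ.filter fun C : Quotient s => ∃ v ∈ N, (⟦v⟧ : Quotient s) = C).card
      ≤ Fintype.card (Quotient s) + 1 := by
  obtain ⟨v₀, hv₀⟩ := hN
  set H := Finset.univ.filter fun C : Quotient s => ∃ v ∈ N, (⟦v⟧ : Quotient s) = C with hH
  have hle : s ≤ s ⊔ mergeSetoid N := le_sup_left
  let φ : Quotient s → Quotient (s ⊔ mergeSetoid N) :=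
    Quotient.map' id (fun a b h => hle h)
  have hφ : ∀ v : V, φ ⟦v⟧ = ⟦v⟧ := fun v => rfl
  have hsurj : (Finset.univ : Finset (Quotient (s ⊔ mergeSetoid N))) ⊆
      (insert (⟦v₀⟧ : Quotient s) Hᶜ).image φ := by
    intro C _
    induction C using Quotient.inductionOn with
    | h v =>
      rw [Finset.mem_image]
      by_cases hv : (⟦v⟧ : Quotient s) ∈ H
      · refine ⟨⟦v₀⟧, Finset.mem_insert_self _ _, ?_⟩
        obtain ⟨v', hv', hvv⟩ := (Finset.mem_filter.mp hv).2
        have h1 : (⟦v⟧ : Quotient (s ⊔ mergeSetoid N)) = ⟦v'⟧ := by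
          rw [← hφ, ← hφ, hvv]
        rw [hφ, h1]
        exact Quotient.sound ((le_sup_right : mergeSetoid N ≤ s ⊔ mergeSetoid N)
          (Or.inr ⟨hv₀, hv'⟩))
      · exact ⟨⟦v⟧, Finset.mem_insert_of_mem (Finset.mem_compl.mpr hv), hφ v⟩
  have h1 := (Finset.card_le_card hsurj).trans Finset.card_image_le
  have h2 := h1.trans (Finset.card_insert_le _ _)
  rw [Finset.card_univ, Finset.card_compl] at h2
  have h3 : H.card ≤ Fintype.card (Quotient s) := Finset.card_le_univ _
  omega

open scoped Classical in
/-- The number of classes if there are at least two, and `0` otherwise. -/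
noncomputable def classPotential (s : Setoid V) : ℝ :=
  if 2 ≤ Fintype.card (Quotient s) then (Fintype.card (Quotient s) : ℝ) else 0

theorem classPotential_nonneg (s : Setoid V) : 0 ≤ classPotential s := by
  unfold classPotential
  split_ifs <;> positivity

open scoped Classical in
-- If `N` meets `h ≥ 2` classes, merging removes `h - 1 ≥ h / 2` of them, and at most `h` classes
-- are separated from their complement by `N`. This trades the global loss for a sum over classes,
-- to which the cut hypothesis applies term by term.
theorem classPotential_sup_mergeSetoid_le (s : Setoid V) (N : Set V) :
    classPotential (s ⊔ mergeSetoid N) ≤ Fintype.card (Quotient s) -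
      (1 / 2) * ∑ C : Quotient s,
        (if (N ∩ {v | ⟦v⟧ = C}).Nonempty ∧ (N ∩ {v | ⟦v⟧ = C}ᶜ).Nonempty then (1 : ℝ) else 0) := by
  set H := Finset.univ.filter fun C : Quotient s => ∃ v ∈ N, (⟦v⟧ : Quotient s) = C with hH
  have hle : (Fintype.card (Quotient (s ⊔ mergeSetoid N)) : ℝ) ≤ Fintype.card (Quotient s) := by
    have hle : s ≤ s ⊔ mergeSetoid N := le_sup_left
    have : Function.Surjective (Quotient.map' id (fun a b h => hle h) :
        Quotient s → Quotient (s ⊔ mergeSetoid N)) := by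
      intro C
      induction C using Quotient.inductionOn with
      | h v => exact ⟨⟦v⟧, rfl⟩
    exact_mod_cast Fintype.card_le_of_surjective _ this
  have hpot : classPotential (s ⊔ mergeSetoid N) ≤ Fintype.card (Quotient (s ⊔ mergeSetoid N)) := by
    unfold classPotential
    split_ifs
    · exact le_rfl
    · positivity
  by_cases h2 : 2 ≤ H.card
  · have hne : N.Nonempty := by
      obtain ⟨C, hC⟩ := Finset.card_pos.mp (by omega : 0 < H.card)
      obtain ⟨v, hv, _⟩ := (Finset.mem_filter.mp hC).2
      exact ⟨v, hv⟩
    have h3 : (Fintype.card (Quotient (s ⊔ mergeSetoid N)) : ℝ) + H.card ≤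
        Fintype.card (Quotient s) + 1 := by
      exact_mod_cast card_quotient_sup_mergeSetoid s N hne
    have h4 : ∑ C : Quotient s,
        (if (N ∩ {v | ⟦v⟧ = C}).Nonempty ∧ (N ∩ {v | ⟦v⟧ = C}ᶜ).Nonempty then (1 : ℝ) else 0)
        ≤ H.card := by
      rw [Finset.sum_boole]
      refine Nat.cast_le.mpr (Finset.card_le_card fun C hC => ?_)
      obtain ⟨⟨v, hv, hvC⟩, _⟩ := (Finset.mem_filter.mp hC).2
      exact Finset.mem_filter.mpr ⟨Finset.mem_univ _, v, hv, hvC⟩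
    have h5 : (2 : ℝ) ≤ H.card := by exact_mod_cast h2
    linarith
  -- A class that `N` meets both inside and outside would give two classes meeting `N`, so here the
  -- sum is empty.
  · have h4 : ∑ C : Quotient s,
        (if (N ∩ {v | ⟦v⟧ = C}).Nonempty ∧ (N ∩ {v | ⟦v⟧ = C}ᶜ).Nonempty then (1 : ℝ) else 0)
        = 0 := by
      refine Finset.sum_eq_zero fun C _ => if_neg ?_
      rintro ⟨⟨v, hv, hvC⟩, v', hv', hvC'⟩
      refine h2 (Finset.one_lt_card.mpr ⟨⟦v⟧, ?_, ⟦v'⟧, ?_, ?_⟩)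
      · exact Finset.mem_filter.mpr ⟨Finset.mem_univ _, v, hv, rfl⟩
      · exact Finset.mem_filter.mpr ⟨Finset.mem_univ _, v', hv', rfl⟩
      · intro h
        exact hvC' (h.symm.trans hvC)
    rw [h4]
    linarith

variable {τ : Type*} [Fintype τ]

open scoped Classical in
-- Each of the `k ≥ 2` classes is a cut crossed with probability at least `p`, so the expected loss
-- is at least `p k / 2`. A single class has potential 0 and stays single; this is why the potential
-- is truncated, as the plain count could not contract below 1.
theorem sum_classPotential_step {w : τ → ℝ} (hw : ∀ t, 0 ≤ w t) (hw1 : ∑ t, w t = 1)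
    (N : τ → Set V) {p : ℝ}
    (hp : ∀ S : Set V, S.Nonempty → Sᶜ.Nonempty →
      p ≤ ∑ t, w t * if (N t ∩ S).Nonempty ∧ (N t ∩ Sᶜ).Nonempty then 1 else 0) (s : Setoid V) :
    ∑ t, w t * classPotential (s ⊔ mergeSetoid (N t)) ≤ (1 - p / 2) * classPotential s := by
  by_cases hs : 2 ≤ Fintype.card (Quotient s)
  · have h1 : ∑ t, w t * classPotential (s ⊔ mergeSetoid (N t)) ≤
        ∑ t, w t * (Fintype.card (Quotient s) - (1 / 2) * ∑ C : Quotient s,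
          (if (N t ∩ {v | ⟦v⟧ = C}).Nonempty ∧ (N t ∩ {v | ⟦v⟧ = C}ᶜ).Nonempty
            then (1 : ℝ) else 0)) :=
      Finset.sum_le_sum fun t _ => mul_le_mul_of_nonneg_left
        (classPotential_sup_mergeSetoid_le s (N t)) (hw t)
    have h2 : ∑ t, w t * (Fintype.card (Quotient s) - (1 / 2) * ∑ C : Quotient s,
          (if (N t ∩ {v | ⟦v⟧ = C}).Nonempty ∧ (N t ∩ {v | ⟦v⟧ = C}ᶜ).Nonempty
            then (1 : ℝ) else 0)) = Fintype.card (Quotient s) - (1 / 2) * ∑ C : Quotient s,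
          ∑ t, w t * (if (N t ∩ {v | ⟦v⟧ = C}).Nonempty ∧ (N t ∩ {v | ⟦v⟧ = C}ᶜ).Nonempty
            then (1 : ℝ) else 0) := by
      simp only [mul_sub, Finset.sum_sub_distrib, ← Finset.sum_mul, hw1, one_mul]
      congr 1
      rw [Finset.sum_comm, Finset.mul_sum]
      refine Finset.sum_congr rfl fun t _ => ?_
      rw [Finset.mul_sum, Finset.mul_sum, Finset.mul_sum]
      exact Finset.sum_congr rfl fun C _ => by ring
    have h3 : ∑ _C : Quotient s, p ≤ ∑ C : Quotient s,
          ∑ t, w t * (if (N t ∩ {v | ⟦v⟧ = C}).Nonempty ∧ (N t ∩ {v | ⟦v⟧ = C}ᶜ).Nonempty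
            then (1 : ℝ) else 0) := by
      refine Finset.sum_le_sum fun C _ => hp _ ?_ ?_
      · obtain ⟨v, rfl⟩ := Quotient.exists_rep C
        exact ⟨v, rfl⟩
      · obtain ⟨C', hC'⟩ := Fintype.exists_ne_of_one_lt_card (by omega) C
        obtain ⟨v, rfl⟩ := Quotient.exists_rep C'
        exact ⟨v, hC'⟩
    rw [Finset.sum_const, Finset.card_univ, nsmul_eq_mul] at h3
    have h4 : classPotential s = Fintype.card (Quotient s) := if_pos hs
    rw [h4]
    linarith
  · have h4 : classPotential s = 0 := if_neg hs
    have h5 : ∀ t, classPotential (s ⊔ mergeSetoid (N t)) = 0 := by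
      intro t
      refine if_neg fun h => hs (h.trans ?_)
      have hle : s ≤ s ⊔ mergeSetoid (N t) := le_sup_left
      refine Fintype.card_le_of_surjective (Quotient.map' id (fun a b h => hle h) :
        Quotient s → Quotient (s ⊔ mergeSetoid (N t))) ?_
      intro C
      induction C using Quotient.inductionOn with
      | h v => exact ⟨⟦v⟧, rfl⟩
    simp [h4, h5]

theorem pexp_fin_succ {m : ℕ} {α : Type*} [Fintype α] (w : Fin (m + 1) → α → ℝ)
    (F : (Fin (m + 1) → α) → ℝ) :
    pexp w F = ∑ t, w 0 t * pexp (fun i => w i.succ) fun T => F (Fin.cons t T) := by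
  unfold pexp
  rw [← (Fin.consEquiv fun _ => α).sum_comp, Fintype.sum_prod_type]
  refine Finset.sum_congr rfl fun t _ => ?_
  rw [Finset.mul_sum]
  refine Finset.sum_congr rfl fun T _ => ?_
  rw [Fin.prod_univ_succ]
  simp [Fin.consEquiv, mul_assoc]

open scoped Classical in
-- Condition on the first hyperedge; the induction runs over all `s` because the process then
-- restarts from the merged relation.
theorem pexp_classPotential_le {w : τ → ℝ} (hw : ∀ t, 0 ≤ w t) (hw1 : ∑ t, w t = 1)
    (N : τ → Set V) {p : ℝ} (hp2 : p ≤ 2)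
    (hp : ∀ S : Set V, S.Nonempty → Sᶜ.Nonempty →
      p ≤ ∑ t, w t * if (N t ∩ S).Nonempty ∧ (N t ∩ Sᶜ).Nonempty then 1 else 0) (m : ℕ) :
    ∀ s : Setoid V, pexp (fun _ : Fin m => w)
      (fun T => classPotential (s ⊔ ⨆ i, mergeSetoid (N (T i)))) ≤
        (1 - p / 2) ^ m * classPotential s := by
  induction m with
  | zero =>
    intro s
    have : ∀ T : Fin 0 → τ, s ⊔ ⨆ i, mergeSetoid (N (T i)) = s := fun T => by
      rw [iSup_of_empty, sup_bot_eq]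
    simp only [this, pow_zero, one_mul]
    exact (pexp_const (fun _ => hw1) _).le
  | succ m ih =>
    intro s
    rw [pexp_fin_succ]
    have hsplit : ∀ (t : τ) (T : Fin m → τ),
        s ⊔ ⨆ i, mergeSetoid (N ((Fin.cons t T : Fin (m + 1) → τ) i)) =
          (s ⊔ mergeSetoid (N t)) ⊔ ⨆ i, mergeSetoid (N (T i)) := by
      intro t T
      refine le_antisymm (sup_le (le_sup_left.trans le_sup_left) (iSup_le fun i => ?_))
        (sup_le (sup_le le_sup_left ?_) (iSup_le fun i => ?_))
      · refine Fin.cases ?_ (fun j => ?_) i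
        · exact le_sup_right.trans le_sup_left
        · exact (le_iSup (fun i => mergeSetoid (N (T i))) j).trans le_sup_right
      · exact (le_iSup (fun i => mergeSetoid (N ((Fin.cons t T : Fin (m + 1) → τ) i)))
          (0 : Fin (m + 1))).trans le_sup_right
      · exact (le_iSup (fun i => mergeSetoid (N ((Fin.cons t T : Fin (m + 1) → τ) i)))
          i.succ).trans le_sup_right
    simp only [hsplit]
    calc _ ≤ ∑ t, w t * ((1 - p / 2) ^ m * classPotential (s ⊔ mergeSetoid (N t))) :=
          Finset.sum_le_sum fun t _ => mul_le_mul_of_nonneg_left (ih _) (hw t)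
      _ = (1 - p / 2) ^ m * ∑ t, w t * classPotential (s ⊔ mergeSetoid (N t)) := by
          rw [Finset.mul_sum]
          exact Finset.sum_congr rfl fun t _ => by ring
      _ ≤ (1 - p / 2) ^ m * ((1 - p / 2) * classPotential s) :=
          mul_le_mul_of_nonneg_left (sum_classPotential_step hw hw1 N hp s)
            (pow_nonneg (by linarith) m)
      _ = _ := by ring

open scoped Classical in
/-- Independent random hyperedges that cross every cut with probability at least `p` connect
the vertex set, up to an exponentially small probability. -/
theorem pexp_not_connected_le {I : Type*} [Fintype I] [DecidableEq I] {w : τ → ℝ} (hw : ∀ t, 0 ≤ w t)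
    (hw1 : ∑ t, w t = 1) (N : τ → Set V) {p : ℝ} (hp2 : p ≤ 2)
    (hp : ∀ S : Set V, S.Nonempty → Sᶜ.Nonempty →
      p ≤ ∑ t, w t * if (N t ∩ S).Nonempty ∧ (N t ∩ Sᶜ).Nonempty then 1 else 0) :
    pexp (fun _ : I => w) (fun T => if (⨆ i, mergeSetoid (N (T i))) = ⊤ then 0 else 1) ≤
        (1 - p / 2) ^ Fintype.card I * Fintype.card V := by
  have hE := pexp_equiv (Fintype.equivFin I).symm (fun _ : I => w)
    (fun T => classPotential ((⊥ : Setoid V) ⊔ ⨆ i, mergeSetoid (N (T i))))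
  have hm := pexp_classPotential_le hw hw1 N hp2 hp (Fintype.card I) ⊥
  rw [← hE] at hm
  -- Markov's inequality: a relation other than `⊤` has at least two classes, hence potential at
  -- least 1.
  refine le_trans (pexp_mono (fun _ => hw) fun T => ?_) (hm.trans ?_)
  · rw [bot_sup_eq, (Fintype.equivFin I).symm.iSup_comp (g := fun i => mergeSetoid (N (T i)))]
    split_ifs with h
    · exact classPotential_nonneg _
    · unfold classPotential
      rw [if_pos]
      · have : 2 ≤ Fintype.card (Quotient (⨆ i, mergeSetoid (N (T i)))) := by
          by_contra hlt
          refine h (Setoid.eq_top_iff.mpr fun u v => ?_)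
          have := Fintype.card_le_one_iff.mp (by omega :
            Fintype.card (Quotient (⨆ i, mergeSetoid (N (T i)))) ≤ 1) ⟦u⟧ ⟦v⟧
          exact Quotient.exact this
        have : (2 : ℝ) ≤ Fintype.card (Quotient (⨆ i, mergeSetoid (N (T i)))) := by
          exact_mod_cast this
        linarith
      · by_contra hlt
        refine h (Setoid.eq_top_iff.mpr fun u v => ?_)
        have := Fintype.card_le_one_iff.mp (by omega :
            Fintype.card (Quotient (⨆ i, mergeSetoid (N (T i)))) ≤ 1) ⟦u⟧ ⟦v⟧
        exact Quotient.exact this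
  · refine mul_le_mul_of_nonneg_left ?_ (pow_nonneg (by linarith) _)
    have h1 : classPotential (⊥ : Setoid V) ≤ Fintype.card (Quotient (⊥ : Setoid V)) := by
      unfold classPotential
      split_ifs
      · exact le_rfl
      · positivity
    refine h1.trans ?_
    exact_mod_cast Fintype.card_le_of_surjective (fun v => (⟦v⟧ : Quotient (⊥ : Setoid V)))
      Quotient.mk_surjective

end Drift

/-! ### The random graph as a product measure and its bipartite marginals. -/

section Model

/-- The probability that a node has the attributes `b`. -/
noncomputable def attrProb (μ : ℝ) {l : ℕ} (b : Fin l → Fin 2) : ℝ :=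
  ∏ i, if b i = 0 then μ else 1 - μ

/-- The edge probability of two nodes with attributes `b` and `c`. -/
noncomputable def affinity (Θ : Matrix (Fin 2) (Fin 2) ℝ) {l : ℕ} (b c : Fin l → Fin 2) : ℝ :=
  ∏ i, Θ (b i) (c i)

/-- The probability that a node with attributes `b` is joined to a given other node. -/
noncomputable def meanAffinity (μ : ℝ) (Θ : Matrix (Fin 2) (Fin 2) ℝ) {l : ℕ}
    (b : Fin l → Fin 2) : ℝ :=
  ∑ c, attrProb μ c * affinity Θ b c

open scoped Classical in
/-- The Bernoulli weights. -/
noncomputable def bern (p : ℝ) (x : Prop) : ℝ := if x then p else 1 - p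

open scoped Classical in
/-- The expectation of a function of the attributes and the graph. -/
noncomputable def expect (μ : ℝ) (Θ : Matrix (Fin 2) (Fin 2) ℝ) {n l : ℕ}
    (F : (Fin n → Fin l → Fin 2) → SimpleGraph (Fin n) → ℝ) : ℝ :=
  ∑ a, ∑ G, attrWeight μ a * graphWeight Θ a G * F a G

/-- A symmetric matrix of affinities between zero and one, for which the attribute `0`
is the more attractive one. -/
structure IsAffinity (Θ : Matrix (Fin 2) (Fin 2) ℝ) : Prop where
  nonneg : ∀ i j, 0 ≤ Θ i j
  le_one : ∀ i j, Θ i j ≤ 1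
  symm : ∀ i j, Θ i j = Θ j i
  anti : ∀ i, Antitone (Θ i)

variable {μ : ℝ} {Θ : Matrix (Fin 2) (Fin 2) ℝ} {n l : ℕ}

theorem attrWeight_eq (a : Fin n → Fin l → Fin 2) : attrWeight μ a = ∏ u, attrProb μ (a u) := by
  unfold attrWeight attrProb
  refine Finset.prod_congr rfl fun u _ => Finset.prod_congr rfl fun i _ => ?_
  congr

theorem attrProb_nonneg (h0 : 0 ≤ μ) (h1 : μ ≤ 1) (b : Fin l → Fin 2) : 0 ≤ attrProb μ b := by
  refine Finset.prod_nonneg fun i _ => ?_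
  split_ifs
  · exact h0
  · linarith

theorem sum_attrProb_mul_prod (g : Fin 2 → Fin l → ℝ) :
    ∑ b : Fin l → Fin 2, attrProb μ b * ∏ i, g (b i) i = ∏ i, (μ * g 0 i + (1 - μ) * g 1 i) := by
  unfold attrProb
  simp only [← Finset.prod_mul_distrib]
  rw [← Fintype.prod_sum fun (i : Fin l) (x : Fin 2) => (if x = 0 then μ else 1 - μ) * g x i]
  simp [Fin.sum_univ_two]

theorem sum_attrProb : ∑ b : Fin l → Fin 2, attrProb μ b = 1 := by
  have := sum_attrProb_mul_prod (μ := μ) (l := l) fun _ _ => 1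
  simpa using this

theorem meanAffinity_eq (b : Fin l → Fin 2) :
    meanAffinity μ Θ b = ∏ i, (μ * Θ (b i) 0 + (1 - μ) * Θ (b i) 1) :=
  sum_attrProb_mul_prod fun x i => Θ (b i) x

theorem sum_bern (p : ℝ) : ∑ x : Prop, bern p x = 1 := by
  simp [bern]

theorem bern_nonneg {p : ℝ} (h0 : 0 ≤ p) (h1 : p ≤ 1) (x : Prop) : 0 ≤ bern p x := by
  unfold bern
  split_ifs
  · exact h0
  · linarith

theorem IsAffinity.affinity_nonneg (h : IsAffinity Θ) (b c : Fin l → Fin 2) :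
    0 ≤ affinity Θ b c :=
  Finset.prod_nonneg fun _ _ => h.nonneg _ _

theorem IsAffinity.affinity_le_one (h : IsAffinity Θ) (b c : Fin l → Fin 2) :
    affinity Θ b c ≤ 1 :=
  Finset.prod_le_one (fun _ _ => h.nonneg _ _) fun _ _ => h.le_one _ _

theorem IsAffinity.affinity_comm (h : IsAffinity Θ) (b c : Fin l → Fin 2) :
    affinity Θ b c = affinity Θ c b :=
  Finset.prod_congr rfl fun _ _ => h.symm _ _

theorem IsAffinity.affinity_anti (h : IsAffinity Θ) (b : Fin l → Fin 2) :
    Antitone (affinity Θ b) := fun _ _ hc =>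
  Finset.prod_le_prod (fun _ _ => h.nonneg _ _) fun i _ => h.anti _ (hc i)

theorem IsAffinity.affinity_anti_left (h : IsAffinity Θ) (b : Fin l → Fin 2) :
    Antitone fun c => affinity Θ c b := by
  simp only [h.affinity_comm _ b]
  exact h.affinity_anti b

theorem attrWeight_nonneg (h0 : 0 ≤ μ) (h1 : μ ≤ 1) (a : Fin n → Fin l → Fin 2) :
    0 ≤ attrWeight μ a := by
  rw [attrWeight_eq]
  exact Finset.prod_nonneg fun _ _ => attrProb_nonneg h0 h1 _

theorem IsAffinity.graphWeight_nonneg (h : IsAffinity Θ) (a : Fin n → Fin l → Fin 2)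
    (G : SimpleGraph (Fin n)) : 0 ≤ graphWeight Θ a G :=
  Finset.prod_nonneg fun _ _ => bern_nonneg (h.affinity_nonneg _ _) (h.affinity_le_one _ _) _

theorem expect_mono (h0 : 0 ≤ μ) (h1 : μ ≤ 1) (h : IsAffinity Θ)
    {F F' : (Fin n → Fin l → Fin 2) → SimpleGraph (Fin n) → ℝ} (hF : ∀ a G, F a G ≤ F' a G) :
    expect μ Θ F ≤ expect μ Θ F' :=
  Finset.sum_le_sum fun a _ => Finset.sum_le_sum fun G _ => mul_le_mul_of_nonneg_left (hF a G)
    (mul_nonneg (attrWeight_nonneg h0 h1 a) (h.graphWeight_nonneg a G))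

theorem expect_add (F F' : (Fin n → Fin l → Fin 2) → SimpleGraph (Fin n) → ℝ) :
    expect μ Θ (fun a G => F a G + F' a G) = expect μ Θ F + expect μ Θ F' := by
  simp only [expect, mul_add, Finset.sum_add_distrib]

theorem expect_const_mul (c : ℝ) (F : (Fin n → Fin l → Fin 2) → SimpleGraph (Fin n) → ℝ) :
    expect μ Θ (fun a G => c * F a G) = c * expect μ Θ F := by
  simp only [expect, Finset.mul_sum]
  exact Finset.sum_congr rfl fun a _ => Finset.sum_congr rfl fun G _ => by ring

theorem expect_sum {σ : Type*} (s : Finset σ)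
    (F : σ → (Fin n → Fin l → Fin 2) → SimpleGraph (Fin n) → ℝ) :
    expect μ Θ (fun a G => ∑ x ∈ s, F x a G) = ∑ x ∈ s, expect μ Θ (F x) := by
  classical
  induction s using Finset.induction_on with
  | empty => simp [expect]
  | insert x s hx ih => simp only [Finset.sum_insert hx, expect_add, ih]

open scoped Classical in
theorem prob_eq_expect (E : Set (SimpleGraph (Fin n))) :
    prob n l μ Θ E = expect (l := l) μ Θ (fun _ G => if G ∈ E then 1 else 0) := by
  unfold prob expect
  refine Finset.sum_congr rfl fun a _ => Finset.sum_congr rfl fun G _ => ?_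
  by_cases hG : G ∈ E <;> simp [hG]

theorem expect_attr (F : (Fin n → Fin l → Fin 2) → ℝ) :
    expect μ Θ (fun a _ => F a) = pexp (fun _ => attrProb μ) F := by
  unfold expect pexp
  refine Finset.sum_congr rfl fun a _ => ?_
  rw [← Finset.sum_mul, ← Finset.mul_sum, sum_graphWeight, mul_one, attrWeight_eq]

theorem expect_const (c : ℝ) : expect μ Θ (fun (_ : Fin n → Fin l → Fin 2) _ => c) = c := by
  rw [expect_attr]
  exact pexp_const (fun _ => sum_attrProb) c

/-- The pair formed by two distinct nodes. -/
def sortPair (u v : Fin n) (h : u ≠ v) : Pair n :=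
  if h' : u < v then ⟨(u, v), h'⟩ else ⟨(v, u), lt_of_le_of_ne (not_lt.mp h') h.symm⟩

theorem graphEquiv_symm_adj (f : Pair n → Prop) (u v : Fin n) (h : u ≠ v) :
    ((graphEquiv n).symm f).Adj u v ↔ f (sortPair u v h) := by
  obtain ⟨G, rfl⟩ := (graphEquiv n).surjective f
  rw [Equiv.symm_apply_apply]
  unfold sortPair
  split_ifs
  · exact Iff.rfl
  · exact G.adj_comm u v

theorem IsAffinity.edgeProb_sortPair (hΘ : IsAffinity Θ) (a : Fin n → Fin l → Fin 2)
    (u v : Fin n) (h : u ≠ v) :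
    edgeProb Θ a (sortPair u v h).1.1 (sortPair u v h).1.2 = affinity Θ (a u) (a v) := by
  unfold sortPair
  split_ifs
  · rfl
  · exact hΘ.affinity_comm _ _

open scoped Classical in
theorem sum_graphWeight_mul (a : Fin n → Fin l → Fin 2) (F : SimpleGraph (Fin n) → ℝ) :
    ∑ G, graphWeight Θ a G * F G =
      pexp (fun e : Pair n => bern (edgeProb Θ a e.1.1 e.1.2))
        (fun f => F ((graphEquiv n).symm f)) := by
  unfold pexp
  refine Fintype.sum_equiv (graphEquiv n) _ _ fun G => ?_
  simp only [Equiv.symm_apply_apply]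
  rfl

/-- Two pairs could give the same edge only with the ends swapped, which is impossible as the ends
lie on opposite sides of `D`. Hence the edges across `D` are a subfamily of the independent
coordinates, and the other edges can be summed out. -/
theorem sortPair_injOn {D : Fin n → Prop} :
    Function.Injective fun p : {u // D u} × {u // ¬ D u} =>
      sortPair p.1.1 p.2.1 (fun h => p.2.2 (h ▸ p.1.2)) := by
  rintro ⟨⟨u, hu⟩, ⟨v, hv⟩⟩ ⟨⟨u', hu'⟩, ⟨v', hv'⟩⟩ h
  simp only [sortPair] at h
  have : u = u' ∧ v = v' := by
    split_ifs at h <;> simp only [Subtype.mk.injEq, Prod.mk.injEq] at h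
    · exact h
    · exact absurd hu' (h.2 ▸ hv |> fun x => by simpa using h.2 ▸ hv)
    · exact absurd hu' (h.1 ▸ hv)
    · exact ⟨h.2, h.1⟩
  simp [this.1, this.2]

open scoped Classical in
/-- The distribution of the neighbourhood of a fresh node among nodes with attributes `c`. -/
noncomputable def nbhdProb (μ : ℝ) (Θ : Matrix (Fin 2) (Fin 2) ℝ) {U : Type*} [Fintype U]
    (c : U → Fin l → Fin 2) (t : U → Prop) : ℝ :=
  ∑ b : Fin l → Fin 2, attrProb μ b * ∏ y, bern (affinity Θ b (c y)) (t y)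

open scoped Classical in
/-- Given the attributes of the nodes outside `D`, the neighbourhoods of the nodes in `D` among
these nodes are independent and identically distributed. -/
theorem expect_bipartite (hΘ : IsAffinity Θ) (D : Fin n → Prop) [DecidablePred D]
    (F : ({u // ¬ D u} → Fin l → Fin 2) → ({u // D u} → {u // ¬ D u} → Prop) → ℝ) :
    expect μ Θ (fun a G => F (fun u => a u.1) (fun x y => G.Adj x.1 y.1)) =
      pexp (fun _ => attrProb μ) (fun c =>
        pexp (fun _ : {u // D u} => nbhdProb μ Θ c) fun T => F c T) := by
  have h1 : ∀ a : Fin n → Fin l → Fin 2,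
      ∑ G : SimpleGraph (Fin n), graphWeight Θ a G * F (fun u => a u.1) (fun x y => G.Adj x.1 y.1) =
        ∑ T : {u // D u} → {u // ¬ D u} → Prop,
          (∏ x, ∏ y, bern (affinity Θ (a x.1) (a y.1)) (T x y)) * F (fun u => a u.1) T := by
    intro a
    rw [sum_graphWeight_mul a fun G => F (fun u => a u.1) (fun x y => G.Adj x.1 y.1)]
    have h2 : ∀ f : Pair n → Prop, (fun (x : {u // D u}) (y : {u // ¬ D u}) =>
        ((graphEquiv n).symm f).Adj x.1 y.1) =
        fun x y => f (sortPair x.1 y.1 (fun h => y.2 (h ▸ x.2))) := fun f =>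
      funext fun x => funext fun y => propext (graphEquiv_symm_adj f _ _ _)
    simp only [h2]
    have h3 := pexp_comp_injective (sortPair_injOn (D := D))
      (w := fun e : Pair n => bern (edgeProb Θ a e.1.1 e.1.2)) (fun _ => sum_bern _)
      (fun f => F (fun u => a u.1) fun x y => f (x, y))
    refine h3.trans ?_
    rw [pexp_curry]
    simp only [hΘ.edgeProb_sortPair]
  have h4 : expect μ Θ (fun a G => F (fun u => a u.1) (fun x y => G.Adj x.1 y.1)) =
      pexp (fun _ => attrProb μ) (fun a : Fin n → Fin l → Fin 2 =>
        ∑ T : {u // D u} → {u // ¬ D u} → Prop,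
          (∏ x, ∏ y, bern (affinity Θ (a x.1) (a y.1)) (T x y)) * F (fun u => a u.1) T) := by
    unfold expect pexp
    refine Finset.sum_congr rfl fun a _ => ?_
    beta_reduce
    rw [← h1, Finset.mul_sum, attrWeight_eq]
    exact Finset.sum_congr rfl fun G _ => by ring
  rw [h4]
  -- The nodes outside `D` come first, so that their attributes become the outer expectation and
  -- those of `D` are averaged inside it.
  let e : {u // ¬ D u} ⊕ {u // D u} ≃ Fin n := (Equiv.sumComm _ _).trans (Equiv.sumCompl D)
  have h5 := pexp_equiv e (fun _ => attrProb μ (l := l))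
    (fun a => ∑ T : {u // D u} → {u // ¬ D u} → Prop,
      (∏ x, ∏ y, bern (affinity Θ (a (Sum.inr x)) (a (Sum.inl y))) (T x y)) *
        F (fun u => a (Sum.inl u)) T)
  have he1 : ∀ x, e (Sum.inl x) = x.1 := fun x => rfl
  have he2 : ∀ x, e (Sum.inr x) = x.1 := fun x => rfl
  simp only [he1, he2] at h5
  rw [h5, pexp_sumElim]
  refine congrArg _ (funext fun c => ?_)
  simp only [Sum.elim_inl, Sum.elim_inr]
  rw [pexp_sum]
  unfold pexp
  refine Finset.sum_congr rfl fun T _ => ?_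
  -- With `c` fixed the weight factorizes over the nodes of `D`; averaging each node's own
  -- attributes turns its factor into `nbhdProb`.
  have h6 := pexp_prod (fun _ : {u // D u} => attrProb μ (l := l))
    (fun x b => ∏ y, bern (affinity Θ b (c y)) (T x y))
  unfold pexp at h6
  unfold nbhdProb
  rw [← h6, Finset.sum_mul]
  exact Finset.sum_congr rfl fun g _ => by ring

end Model

/-! ### Good nodes are connected: Harris' inequality and cuts. -/

section Connectivity

variable {μ : ℝ} {Θ : Matrix (Fin 2) (Fin 2) ℝ} {n l : ℕ}

theorem attrProb_mul_le (a b : Fin l → Fin 2) :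
    attrProb μ a * attrProb μ b ≤ attrProb μ (a ⊓ b) * attrProb μ (a ⊔ b) := by
  refine le_of_eq ?_
  unfold attrProb
  rw [← Finset.prod_mul_distrib, ← Finset.prod_mul_distrib]
  refine Finset.prod_congr rfl fun i _ => ?_
  simp only [Pi.inf_apply, Pi.sup_apply]
  rcases le_total (a i) (b i) with h | h
  · simp only [inf_of_le_left h, sup_of_le_right h]
  · simp only [inf_of_le_right h, sup_of_le_left h]
    exact mul_comm _ _

/-- The Harris inequality for decreasing functions of the attributes. -/
theorem attrProb_correlation (h0 : 0 ≤ μ) (h1 : μ ≤ 1) {f g : (Fin l → Fin 2) → ℝ}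
    (hf0 : ∀ b, 0 ≤ f b) (hg0 : ∀ b, 0 ≤ g b) (hf : Antitone f) (hg : Antitone g) :
    (∑ b, attrProb μ b * f b) * ∑ b, attrProb μ b * g b ≤ ∑ b, attrProb μ b * (f b * g b) := by
  -- The functions are decreasing, so FKG is applied in the order dual.
  have := fkg (α := (Fin l → Fin 2)ᵒᵈ) (μ := fun b => attrProb μ (OrderDual.ofDual b))
    (f := fun b => f (OrderDual.ofDual b)) (g := fun b => g (OrderDual.ofDual b))
    (fun b => attrProb_nonneg h0 h1 _) (fun b => hf0 _) (fun b => hg0 _)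
    (fun a b hab => hf hab) (fun a b hab => hg hab)
    (fun a b => by
      have := attrProb_mul_le (μ := μ) (OrderDual.ofDual a) (OrderDual.ofDual b)
      rw [mul_comm (attrProb μ (_ ⊓ _))] at this
      exact this)
  have h2 : ∑ b : (Fin l → Fin 2)ᵒᵈ, attrProb μ (OrderDual.ofDual b) = 1 :=
    sum_attrProb (μ := μ) (l := l)
  rw [h2, one_mul] at this
  exact this

open scoped Classical in
-- Inclusion–exclusion over the events of having no neighbour in `A`, in `B`, and in `A ∪ B`.
theorem pexp_bern_exists {U : Type*} [Fintype U] [DecidableEq U] (p : U → ℝ) {A B : Finset U}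
    (hAB : Disjoint A B) :
    pexp (fun y => bern (p y))
      (fun t => if (∃ y ∈ A, t y) ∧ ∃ y ∈ B, t y then (1 : ℝ) else 0) =
        (1 - ∏ y ∈ A, (1 - p y)) * (1 - ∏ y ∈ B, (1 - p y)) := by
  have key : ∀ A : Finset U, pexp (fun y => bern (p y))
      (fun t => ∏ y, if y ∈ A then (if t y then (0 : ℝ) else 1) else 1) =
        ∏ y ∈ A, (1 - p y) := by
    intro A
    rw [pexp_prod (fun y => bern (p y)) fun y x => if y ∈ A then (if x then (0 : ℝ) else 1) else 1,
      ← Finset.prod_filter_mul_prod_filter_not Finset.univ (· ∈ A)]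
    have e1 : Finset.univ.filter (· ∈ A) = A := by ext; simp
    rw [e1, Finset.prod_eq_one (s := Finset.univ.filter (· ∉ A)), mul_one]
    · refine Finset.prod_congr rfl fun y hy => ?_
      simp [hy, bern]
    · intro y hy
      simp only [(Finset.mem_filter.mp hy).2, if_false, mul_one, sum_bern]
  have ind : ∀ (A : Finset U) (t : U → Prop),
      (∏ y, if y ∈ A then (if t y then (0 : ℝ) else 1) else 1) =
        if ∃ y ∈ A, t y then (0 : ℝ) else 1 := by
    intro A t
    split_ifs with h
    · obtain ⟨y, hy, ht⟩ := h
      exact Finset.prod_eq_zero (Finset.mem_univ y) (by simp [hy, ht])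
    · push Not at h
      refine Finset.prod_eq_one fun y _ => ?_
      by_cases hy : y ∈ A
      · simp [hy, h y hy]
      · simp [hy]
  simp only [ind] at key
  have split : ∀ t : U → Prop, (if (∃ y ∈ A, t y) ∧ ∃ y ∈ B, t y then (1 : ℝ) else 0) =
      1 + (-1) * (if ∃ y ∈ A, t y then (0 : ℝ) else 1)
        + ((-1) * (if ∃ y ∈ B, t y then (0 : ℝ) else 1)
          + if ∃ y ∈ A ∪ B, t y then (0 : ℝ) else 1) := by
    intro t
    have : (∃ y ∈ A ∪ B, t y) ↔ (∃ y ∈ A, t y) ∨ ∃ y ∈ B, t y := by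
      constructor
      · rintro ⟨y, hy, ht⟩
        exact (Finset.mem_union.mp hy).imp (fun h => ⟨y, h, ht⟩) fun h => ⟨y, h, ht⟩
      · rintro (⟨y, hy, ht⟩ | ⟨y, hy, ht⟩)
        · exact ⟨y, Finset.mem_union_left _ hy, ht⟩
        · exact ⟨y, Finset.mem_union_right _ hy, ht⟩
    simp only [this]
    by_cases hA : ∃ y ∈ A, t y <;> by_cases hB : ∃ y ∈ B, t y <;> simp only [hA, hB] <;> norm_num
  simp only [split, pexp_add, pexp_const_mul, key]
  rw [pexp_const (fun _ => sum_bern _), Finset.prod_union hAB]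
  ring

/-- The probability of a neighbour in `A` for a fresh node with attributes `b`. -/
noncomputable def hitProb (Θ : Matrix (Fin 2) (Fin 2) ℝ) {U : Type*}
    (c : U → Fin l → Fin 2) (A : Finset U) (b : Fin l → Fin 2) : ℝ :=
  1 - ∏ y ∈ A, (1 - affinity Θ b (c y))

variable {U : Type*} {c : U → Fin l → Fin 2}

theorem IsAffinity.prod_one_sub_le_one (hΘ : IsAffinity Θ) (A : Finset U) (b : Fin l → Fin 2) :
    ∏ y ∈ A, (1 - affinity Θ b (c y)) ≤ 1 :=
  Finset.prod_le_one (fun _ _ => sub_nonneg.mpr (hΘ.affinity_le_one _ _))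
    fun _ _ => sub_le_self _ (hΘ.affinity_nonneg _ _)

theorem IsAffinity.hitProb_nonneg (hΘ : IsAffinity Θ) (A : Finset U) (b : Fin l → Fin 2) :
    0 ≤ hitProb Θ c A b := sub_nonneg.mpr (hΘ.prod_one_sub_le_one A b)

theorem IsAffinity.hitProb_anti (hΘ : IsAffinity Θ) (A : Finset U) :
    Antitone (hitProb Θ c A) := fun _ _ hb =>
  sub_le_sub_left (Finset.prod_le_prod (fun _ _ => sub_nonneg.mpr (hΘ.affinity_le_one _ _))
    fun _ _ => sub_le_sub_left (hΘ.affinity_anti_left _ hb) _) _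

theorem IsAffinity.affinity_le_hitProb (hΘ : IsAffinity Θ) {A : Finset U} {y : U} (hy : y ∈ A)
    (b : Fin l → Fin 2) : affinity Θ b (c y) ≤ hitProb Θ c A b := by
  classical
  unfold hitProb
  rw [← Finset.mul_prod_erase A _ hy]
  have := mul_le_of_le_one_right (sub_nonneg.mpr (hΘ.affinity_le_one b (c y)))
    (hΘ.prod_one_sub_le_one (c := c) (A.erase y) b)
  linarith

theorem IsAffinity.hitProb_union_le [DecidableEq U] (hΘ : IsAffinity Θ) {A B : Finset U} (hAB : Disjoint A B)
    (b : Fin l → Fin 2) : hitProb Θ c (A ∪ B) b ≤ hitProb Θ c A b + hitProb Θ c B b := by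
  unfold hitProb
  rw [Finset.prod_union hAB]
  have h1 := mul_nonneg (sub_nonneg.mpr (hΘ.prod_one_sub_le_one (c := c) A b))
    (sub_nonneg.mpr (hΘ.prod_one_sub_le_one (c := c) B b))
  linarith

theorem IsAffinity.meanAffinity_le_sum_hitProb (hΘ : IsAffinity Θ) (h0 : 0 ≤ μ) (h1 : μ ≤ 1)
    {A : Finset U} {y : U} (hy : y ∈ A) :
    meanAffinity μ Θ (c y) ≤ ∑ b, attrProb μ b * hitProb Θ c A b := by
  unfold meanAffinity
  refine Finset.sum_le_sum fun b _ => mul_le_mul_of_nonneg_left ?_ (attrProb_nonneg h0 h1 _)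
  rw [hΘ.affinity_comm]
  exact hΘ.affinity_le_hitProb hy b

variable [Fintype U]

theorem nbhdProb_nonneg (h0 : 0 ≤ μ) (h1 : μ ≤ 1) (hΘ : IsAffinity Θ) (t : U → Prop) :
    0 ≤ nbhdProb μ Θ c t :=
  Finset.sum_nonneg fun _ _ => mul_nonneg (attrProb_nonneg h0 h1 _)
    (Finset.prod_nonneg fun _ _ => bern_nonneg (hΘ.affinity_nonneg _ _) (hΘ.affinity_le_one _ _) _)

open scoped Classical in
theorem sum_nbhdProb_mul [DecidableEq U] (F : (U → Prop) → ℝ) :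
    ∑ t, nbhdProb μ Θ c t * F t =
      ∑ b, attrProb μ b * pexp (fun y => bern (affinity Θ b (c y))) F := by
  unfold nbhdProb pexp
  simp only [Finset.sum_mul, Finset.mul_sum]
  rw [Finset.sum_comm]
  exact Finset.sum_congr rfl fun b _ => Finset.sum_congr rfl fun t _ => by ring

open scoped Classical in
theorem sum_nbhdProb [DecidableEq U] : ∑ t, nbhdProb μ Θ c t = 1 := by
  have := sum_nbhdProb_mul (μ := μ) (Θ := Θ) (c := c) fun _ => 1
  simp only [mul_one] at this
  rw [this]
  simp only [pexp_const (fun _ => sum_bern _), mul_one, sum_attrProb]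

open scoped Classical in
/-- A fresh node has neighbours on both sides of a cut with probability at least
`δ * q / 2`, if each node of the cut has mean affinity at least `δ` and the fresh node has any
neighbour with probability at least `q`. -/
theorem IsAffinity.cut_le [DecidableEq U] (hΘ : IsAffinity Θ) (h0 : 0 ≤ μ) (h1 : μ ≤ 1) {A B : Finset U}
    (hAB : Disjoint A B) (hA : A.Nonempty) (hB : B.Nonempty) {δ q : ℝ} (hδ0 : 0 ≤ δ)
    (hδ : ∀ y ∈ A ∪ B, δ ≤ meanAffinity μ Θ (c y))
    (hq : q ≤ ∑ b, attrProb μ b * hitProb Θ c (A ∪ B) b) :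
    δ * (q / 2) ≤ ∑ t, nbhdProb μ Θ c t *
      if (∃ y ∈ A, t y) ∧ ∃ y ∈ B, t y then (1 : ℝ) else 0 := by
  rw [sum_nbhdProb_mul]
  simp only [pexp_bern_exists _ hAB]
  change δ * (q / 2) ≤ ∑ b, attrProb μ b * (hitProb Θ c A b * hitProb Θ c B b)
  refine le_trans ?_ (attrProb_correlation h0 h1 (hΘ.hitProb_nonneg (c := c) A)
    (hΘ.hitProb_nonneg (c := c) B) (hΘ.hitProb_anti A) (hΘ.hitProb_anti B))
  set a := ∑ b, attrProb μ b * hitProb Θ c A b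
  set b := ∑ b, attrProb μ b * hitProb Θ c B b
  have ha : δ ≤ a := by
    obtain ⟨y, hy⟩ := hA
    exact (hδ y (Finset.mem_union_left _ hy)).trans (hΘ.meanAffinity_le_sum_hitProb h0 h1 hy)
  have hb : δ ≤ b := by
    obtain ⟨y, hy⟩ := hB
    exact (hδ y (Finset.mem_union_right _ hy)).trans (hΘ.meanAffinity_le_sum_hitProb h0 h1 hy)
  have hab : q ≤ a + b := by
    refine hq.trans ?_
    rw [← Finset.sum_add_distrib]
    refine Finset.sum_le_sum fun b _ => ?_
    rw [← mul_add]
    exact mul_le_mul_of_nonneg_left (hΘ.hitProb_union_le hAB b) (attrProb_nonneg h0 h1 _)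
  -- The larger of the two factors is at least `q / 2`, and the smaller is at least `δ`.
  rcases le_total a b with h | h
  · exact (mul_le_mul_of_nonneg_left (by linarith) hδ0).trans
      (mul_le_mul_of_nonneg_right ha (hδ0.trans hb))
  · rw [mul_comm a]
    exact (mul_le_mul_of_nonneg_left (by linarith) hδ0).trans
      (mul_le_mul_of_nonneg_right hb (hδ0.trans ha))

open scoped Classical in
/-- The probability that a fresh node is good but has no good neighbour among nodes with
attributes `c`. -/
noncomputable def missProb (μ : ℝ) (Θ : Matrix (Fin 2) (Fin 2) ℝ) (good : (Fin l → Fin 2) → Prop)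
    (c : U → Fin l → Fin 2) : ℝ :=
  ∑ b, attrProb μ b * if good b then
    ∏ y, (1 - (if good (c y) then affinity Θ b (c y) else 0)) else 0

open scoped Classical in
/-- The probability that a node is good. -/
noncomputable def goodProb (μ : ℝ) (good : (Fin l → Fin 2) → Prop) : ℝ :=
  ∑ b, attrProb μ b * if good b then 1 else 0

open scoped Classical in
theorem goodProb_nonneg (h0 : 0 ≤ μ) (h1 : μ ≤ 1) (good : (Fin l → Fin 2) → Prop) :
    0 ≤ goodProb μ good := by
  refine Finset.sum_nonneg fun b _ => mul_nonneg (attrProb_nonneg h0 h1 b) ?_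
  split_ifs <;> norm_num

open scoped Classical in
theorem goodProb_le_one (h0 : 0 ≤ μ) (h1 : μ ≤ 1) (good : (Fin l → Fin 2) → Prop) :
    goodProb μ good ≤ 1 := by
  rw [← sum_attrProb (μ := μ) (l := l)]
  refine Finset.sum_le_sum fun b _ => mul_le_of_le_one_right (attrProb_nonneg h0 h1 b) ?_
  split_ifs <;> norm_num

variable {good : (Fin l → Fin 2) → Prop}

open scoped Classical in
theorem IsAffinity.missProb_nonneg (hΘ : IsAffinity Θ) (h0 : 0 ≤ μ) (h1 : μ ≤ 1) :
    0 ≤ missProb μ Θ good c := by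
  refine Finset.sum_nonneg fun b _ => mul_nonneg (attrProb_nonneg h0 h1 b) ?_
  split_ifs
  · refine Finset.prod_nonneg fun y _ => ?_
    split_ifs
    · exact sub_nonneg.mpr (hΘ.affinity_le_one _ _)
    · norm_num
  · exact le_rfl

open scoped Classical in
-- A good fresh node that does not miss has a good neighbour in `U`; fresh nodes that are not good
-- only add to the right-hand side.
theorem goodProb_sub_missProb_le (hΘ : IsAffinity Θ) (h0 : 0 ≤ μ) (h1 : μ ≤ 1) :
    goodProb μ good - missProb μ Θ good c ≤
      ∑ b, attrProb μ b * hitProb Θ c (Finset.univ.filter fun y => good (c y)) b := by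
  unfold goodProb missProb
  rw [← Finset.sum_sub_distrib]
  refine Finset.sum_le_sum fun b _ => ?_
  rw [← mul_sub]
  refine mul_le_mul_of_nonneg_left ?_ (attrProb_nonneg h0 h1 _)
  split_ifs
  · unfold hitProb
    rw [Finset.prod_filter]
    refine (le_of_eq ?_)
    congr 1
    refine Finset.prod_congr rfl fun y _ => ?_
    split_ifs <;> simp
  · rw [sub_zero]
    exact hΘ.hitProb_nonneg _ _

open scoped Classical in
-- For a fixed good `b` the nodes of `U` contribute independent factors. Being good and being
-- attractive to `b` are both decreasing in the attributes, so by Harris' inequality a node is good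
-- and joined to `b` with probability at least `goodProb μ good * δ`.
theorem pexp_missProb_le [DecidableEq U] (hΘ : IsAffinity Θ) (h0 : 0 ≤ μ) (h1 : μ ≤ 1)
    (hgood : ∀ b b', b ≤ b' → good b' → good b) {δ : ℝ}
    (hδ : ∀ b, good b → δ ≤ meanAffinity μ Θ b) :
    pexp (fun _ : U => attrProb μ) (fun c => missProb μ Θ good c) ≤
      (1 - goodProb μ good * δ) ^ Fintype.card U := by
  have hb : ∀ b, good b → 0 ≤ 1 - (∑ c, attrProb μ c * if good c then affinity Θ b c else 0) ∧
      1 - (∑ c, attrProb μ c * if good c then affinity Θ b c else 0) ≤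
        1 - goodProb μ good * δ := by
    intro b hb
    constructor
    · rw [← sum_attrProb (μ := μ) (l := l), ← Finset.sum_sub_distrib]
      refine Finset.sum_nonneg fun c _ => sub_nonneg.mpr
        (mul_le_of_le_one_right (attrProb_nonneg h0 h1 c) ?_)
      split_ifs
      · exact hΘ.affinity_le_one _ _
      · norm_num
    · have h2 := attrProb_correlation h0 h1 (f := fun c => if good c then (1 : ℝ) else 0)
        (g := affinity Θ b) (fun c => by split_ifs <;> norm_num) (hΘ.affinity_nonneg b)
        (fun c c' h => by
          by_cases hc : good c'
          · simp [hc, hgood c c' h hc]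
          · simp only [hc, if_false]
            split_ifs <;> norm_num) (hΘ.affinity_anti b)
      have h3 : goodProb μ good * δ ≤ goodProb μ good * meanAffinity μ Θ b :=
        mul_le_mul_of_nonneg_left (hδ b hb) (goodProb_nonneg h0 h1 good)
      have h4 : ∀ c, (if good c then (1 : ℝ) else 0) * affinity Θ b c =
          if good c then affinity Θ b c else 0 := fun c => by split_ifs <;> simp
      simp only [h4] at h2
      have h5 : goodProb μ good * meanAffinity μ Θ b ≤
        ∑ c, attrProb μ c * if good c then affinity Θ b c else 0 := h2
      linarith
  unfold missProb
  rw [pexp_sum]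
  have h6 : ∀ b : Fin l → Fin 2, pexp (fun _ : U => attrProb μ) (fun c => attrProb μ b *
      if good b then ∏ y, (1 - (if good (c y) then affinity Θ b (c y) else 0)) else 0) ≤
        attrProb μ b * (1 - goodProb μ good * δ) ^ Fintype.card U := by
    intro b
    rw [pexp_const_mul]
    refine mul_le_mul_of_nonneg_left ?_ (attrProb_nonneg h0 h1 b)
    by_cases hg : good b
    · simp only [hg, if_true]
      rw [pexp_prod (fun _ : U => attrProb μ)
        fun _ c => (1 - (if good c then affinity Θ b c else 0)), Finset.prod_const,
        Finset.card_univ]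
      have h7 : ∑ c, attrProb μ c * (1 - (if good c then affinity Θ b c else 0)) =
          1 - (∑ c, attrProb μ c * if good c then affinity Θ b c else 0) := by
        simp only [mul_sub, mul_one, Finset.sum_sub_distrib, sum_attrProb]
      rw [h7]
      exact pow_le_pow_left₀ (hb b hg).1 (hb b hg).2 _
    · simp only [hg, if_false]
      rw [pexp_const (fun _ => sum_attrProb)]
      -- Only nonnegativity of the bound is needed here: any good `b'` shows that its base is
      -- nonnegative, and without one the base is 1.
      by_cases hne : ∃ b, good b
      · obtain ⟨b', hb'⟩ := hne
        exact pow_nonneg ((hb b' hb').1.trans (hb b' hb').2) _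
      · push Not at hne
        have : goodProb μ good = 0 := by
          unfold goodProb
          simp [hne]
        rw [this]
        simp
  refine (Finset.sum_le_sum fun b _ => h6 b).trans ?_
  rw [← Finset.sum_mul, sum_attrProb, one_mul]

open scoped Classical in
/-- Given the attributes `c` of the nodes in `U`, independent fresh nodes connect the good nodes
of `U` with high probability. -/
theorem pexp_nbhd_not_connected_le [DecidableEq U] {I : Type*} [Fintype I] [DecidableEq I] (hΘ : IsAffinity Θ) (h0 : 0 ≤ μ)
    (h1 : μ ≤ 1) {δ : ℝ} (hδ0 : 0 ≤ δ) (hδ1 : δ ≤ 1)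
    (hδ : ∀ b, good b → δ ≤ meanAffinity μ Θ b) (hpos : 0 < goodProb μ good) :
    pexp (fun _ : I => nbhdProb μ Θ c) (fun T => if (⨆ i,
        mergeSetoid {v : {y : U // good (c y)} | T i v}) = ⊤ then 0 else 1) ≤
      (1 - δ * goodProb μ good / 8) ^ Fintype.card I * Fintype.card U +
        2 / goodProb μ good * missProb μ Θ good c := by
  have hm := hΘ.missProb_nonneg (c := c) (good := good) h0 h1
  have hg1 := goodProb_le_one h0 h1 good
  have hδg : δ * goodProb μ good ≤ 1 := mul_le_one₀ hδ1 hpos.le hg1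
  -- If `c` is typical, a fresh node has a good neighbour with probability at least `goodProb / 2`.
  -- Otherwise the last term of the bound already exceeds 1.
  by_cases hmiss : missProb μ Θ good c ≤ goodProb μ good / 2
  · have h2 := pexp_not_connected_le (I := I) (w := nbhdProb μ Θ c)
      (nbhdProb_nonneg h0 h1 hΘ) sum_nbhdProb
      (fun t => {v : {y : U // good (c y)} | t v}) (p := δ * (goodProb μ good / 2 / 2))
      (by linarith) ?_
    · refine h2.trans ?_
      have h3 : 1 - δ * (goodProb μ good / 2 / 2) / 2 = 1 - δ * goodProb μ good / 8 := by ring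
      rw [h3]
      have h4 : (Fintype.card {y : U // good (c y)} : ℝ) ≤ Fintype.card U := by
        exact_mod_cast Fintype.card_subtype_le _
      have h5 := mul_le_mul_of_nonneg_left h4
        (pow_nonneg (by linarith : 0 ≤ 1 - δ * goodProb μ good / 8) (Fintype.card I))
      have h6 : 0 ≤ 2 / goodProb μ good * missProb μ Θ good c := by positivity
      linarith
    · intro S hS hS'
      set A : Finset U := S.toFinset.map (Function.Embedding.subtype _) with hA
      set B : Finset U := (Sᶜ).toFinset.map (Function.Embedding.subtype _) with hB
      have hAB : Disjoint A B := by
        rw [hA, hB, Finset.disjoint_map, Set.disjoint_toFinset]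
        exact disjoint_compl_right
      have hun : A ∪ B = Finset.univ.filter fun y => good (c y) := by
        rw [hA, hB, ← Finset.map_union, ← Set.toFinset_union]
        ext y
        simp
      have h3 := hΘ.cut_le (c := c) h0 h1 hAB
        (by rw [hA, Finset.map_nonempty, Set.toFinset_nonempty]; exact hS)
        (by rw [hB, Finset.map_nonempty, Set.toFinset_nonempty]; exact hS') hδ0
        (q := goodProb μ good / 2)
        (fun y hy => hδ _ (by rw [hun] at hy; exact (Finset.mem_filter.mp hy).2))
        (by
          rw [hun]
          have := goodProb_sub_missProb_le (good := good) (c := c) hΘ h0 h1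
          linarith)
      refine h3.trans (le_of_eq ?_)
      refine Finset.sum_congr rfl fun t _ => ?_
      congr 1
      have e : ∀ (S : Set {y : U // good (c y)}) (_ : Fintype S),
          (({v : {y : U // good (c y)} | t v} ∩ S).Nonempty ↔
            ∃ y ∈ S.toFinset.map (Function.Embedding.subtype _), t y) := by
        intro S _
        constructor
        · rintro ⟨v, hv, hvS⟩
          exact ⟨v, Finset.mem_map.mpr ⟨v, Set.mem_toFinset.mpr hvS, rfl⟩, hv⟩
        · rintro ⟨y, hy, ht⟩
          obtain ⟨v, hv, rfl⟩ := Finset.mem_map.mp hy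
          exact ⟨v, ht, Set.mem_toFinset.mp hv⟩
      exact if_congr (and_congr (e S _) (e Sᶜ _)).symm rfl rfl
  · have h2 : pexp (fun _ : I => nbhdProb μ Θ c) (fun T => if (⨆ i,
        mergeSetoid {v : {y : U // good (c y)} | T i v}) = ⊤ then (0 : ℝ) else 1) ≤ 1 := by
      refine (pexp_mono (G := fun _ => 1) (fun _ => nbhdProb_nonneg h0 h1 hΘ) fun T => ?_).trans
        (pexp_const (fun _ => sum_nbhdProb) 1).le
      split_ifs <;> norm_num
    have h3 : 1 ≤ 2 / goodProb μ good * missProb μ Θ good c := by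
      rw [div_mul_eq_mul_div, le_div_iff₀ hpos]
      linarith
    have h4 : 0 ≤ (1 - δ * goodProb μ good / 8) ^ Fintype.card I * (Fintype.card U : ℝ) :=
      mul_nonneg (pow_nonneg (by linarith) _) (by positivity)
    linarith

open scoped Classical in
/-- The good nodes outside `D` are connected through nodes in `D` with high probability. -/
theorem expect_not_reachable_le (hΘ : IsAffinity Θ) (h0 : 0 ≤ μ) (h1 : μ ≤ 1)
    (hgood : ∀ b b', b ≤ b' → good b' → good b) {δ : ℝ} (hδ0 : 0 ≤ δ) (hδ1 : δ ≤ 1)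
    (hδ : ∀ b, good b → δ ≤ meanAffinity μ Θ b) (hpos : 0 < goodProb μ good)
    (D : Fin n → Prop) [DecidablePred D] :
    expect μ Θ (fun a G => if ∃ u v, ¬ D u ∧ ¬ D v ∧ good (a u) ∧ good (a v) ∧ ¬ G.Reachable u v
      then 1 else 0) ≤
      (1 - δ * goodProb μ good / 8) ^ Fintype.card {u // D u} * Fintype.card {u // ¬ D u} +
        2 / goodProb μ good * (1 - goodProb μ good * δ) ^ Fintype.card {u // ¬ D u} := by
  have h2 := expect_bipartite (μ := μ) hΘ D (fun (c : {u // ¬ D u} → Fin l → Fin 2) T =>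
    if (⨆ i, mergeSetoid {v : {y : {u // ¬ D u} // good (c y)} | T i v}) = ⊤ then (0 : ℝ) else 1)
  refine (expect_mono h0 h1 hΘ fun a G => ?_).trans (h2.le.trans ?_)
  · by_cases hT : (⨆ i : {u // D u}, mergeSetoid
      {v : {y : {u // ¬ D u} // good (a y.1)} | G.Adj i.1 v.1.1}) = ⊤
    · rw [if_pos hT, if_neg]
      rintro ⟨u, v, hu, hv, hgu, hgv, hr⟩
      refine hr ?_
      -- Reachability in `G` is an equivalence relation containing every hyperedge, since two
      -- neighbours of a node of `D` are joined through it.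
      let s : Setoid {y : {u // ¬ D u} // good (a y.1)} :=
        { r := fun x y => G.Reachable x.1.1 y.1.1
          iseqv := ⟨fun _ => SimpleGraph.Reachable.refl _, fun h => h.symm,
            fun h h' => h.trans h'⟩ }
      have hs : ⊤ ≤ s := by
        rw [← hT]
        refine iSup_le fun i x y hxy => ?_
        rcases hxy with rfl | ⟨hx, hy⟩
        · exact SimpleGraph.Reachable.refl _
        · exact (SimpleGraph.Adj.reachable hx).symm.trans (SimpleGraph.Adj.reachable hy)
      have hs' : s = ⊤ := top_le_iff.mp hs
      have hr := Setoid.eq_top_iff.mp hs' ⟨⟨u, hu⟩, hgu⟩ ⟨⟨v, hv⟩, hgv⟩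
      exact hr
    · rw [if_neg hT]
      split_ifs <;> norm_num
  · have h3 := fun c : {u // ¬ D u} → Fin l → Fin 2 => pexp_nbhd_not_connected_le
      (I := {u // D u}) (c := c) (good := good) hΘ h0 h1 hδ0 hδ1 hδ hpos
    refine (pexp_mono (fun _ => attrProb_nonneg h0 h1) h3).trans ?_
    rw [pexp_add, pexp_const (fun _ => sum_attrProb), pexp_const_mul]
    have := mul_le_mul_of_nonneg_left
      (pexp_missProb_le (U := {u // ¬ D u}) hΘ h0 h1 hgood hδ)
      (by positivity : 0 ≤ 2 / goodProb μ good)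
    linarith

end Connectivity

/-! ### The central limit theorem for the attribute sum. -/

section CentralLimit

open MeasureTheory ProbabilityTheory

/-- The standardization of an attribute. -/
noncomputable def standardized (μ : ℝ) (x : Fin 2) : ℝ :=
  (if x = 0 then 1 - μ else -μ) / √(μ * (1 - μ))

/-- The law of an attribute. -/
noncomputable def attrLaw (μ : ℝ) : Measure (Fin 2) :=
  ENNReal.ofReal μ • Measure.dirac 0 + ENNReal.ofReal (1 - μ) • Measure.dirac 1

theorem isProbabilityMeasure_attrLaw {μ : ℝ} (h0 : 0 ≤ μ) (h1 : μ ≤ 1) :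
    IsProbabilityMeasure (attrLaw μ) := by
  constructor
  simp only [attrLaw, Measure.coe_add, Measure.coe_smul, Pi.add_apply, Pi.smul_apply,
    measure_univ, smul_eq_mul, mul_one]
  rw [← ENNReal.ofReal_add h0 (by linarith)]
  simp

theorem attrLaw_singleton {μ : ℝ} (x : Fin 2) :
    attrLaw μ {x} = ENNReal.ofReal (if x = 0 then μ else 1 - μ) := by
  fin_cases x <;> simp [attrLaw]

theorem integral_attrLaw {μ : ℝ} (h0 : 0 ≤ μ) (h1 : μ ≤ 1) (f : Fin 2 → ℝ) :
    ∫ x, f x ∂(attrLaw μ) = μ * f 0 + (1 - μ) * f 1 := by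
  unfold attrLaw
  rw [integral_add_measure ((integrable_dirac (by simp)).smul_measure (by simp))
    ((integrable_dirac (by simp)).smul_measure (by simp)), integral_smul_measure,
    integral_smul_measure, integral_dirac, integral_dirac, ENNReal.toReal_ofReal h0,
    ENNReal.toReal_ofReal (by linarith), smul_eq_mul, smul_eq_mul]

open scoped Classical in
-- Realizes the attribute vectors of all lengths on one probability space, as the central limit
-- theorem requires.
theorem infinitePi_attrLaw_cylinder {μ : ℝ} (h0 : 0 ≤ μ) (h1 : μ ≤ 1) {l : ℕ}
    (good : (Fin l → Fin 2) → Prop) :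
    (Measure.infinitePi fun _ : ℕ => attrLaw μ).real {ω | good fun i => ω i} =
      goodProb μ good := by
  have := isProbabilityMeasure_attrLaw h0 h1
  have hmap := Measure.map_infinitePi_infinitePi_of_inj (P := fun _ : ℕ => attrLaw μ)
    (Fin.val_injective (n := l))
  have h2 : (Measure.infinitePi fun _ : ℕ => attrLaw μ).real {ω | good fun i => ω i} =
      (Measure.infinitePi fun _ : Fin l => attrLaw μ).real {b | good b} := by
    rw [← hmap, map_measureReal_apply (by fun_prop) (Set.toFinite _).measurableSet]
    rfl
  have h3 : ({b | good b} : Set (Fin l → Fin 2)) = ↑(Finset.univ.filter good) := by simp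
  rw [h2, h3, ← sum_measureReal_singleton, goodProb, Finset.sum_filter]
  refine Finset.sum_congr rfl fun b _ => ?_
  split_ifs
  · rw [Measure.real, Measure.infinitePi_singleton_of_fintype, ENNReal.toReal_prod, mul_one]
    unfold attrProb
    refine Finset.prod_congr rfl fun i _ => ?_
    rw [attrLaw_singleton, ENNReal.toReal_ofReal]
    split_ifs <;> linarith
  · rw [mul_zero]

/-- Convergence in distribution passes to the half-line `[t, ∞)` because its boundary point has
Gaussian measure 0. -/
theorem tendsto_goodProb_standardized {μ : ℝ} (h0 : 0 < μ) (h1 : μ < 1) (t : ℝ) :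
    Tendsto (fun l : ℕ => goodProb μ fun b : Fin l → Fin 2 =>
      t ≤ (√l)⁻¹ * ∑ i, standardized μ (b i)) atTop
      (𝓝 ((gaussianReal 0 1).real (Set.Ici t))) := by
  have := isProbabilityMeasure_attrLaw h0.le h1.le
  have hv : 0 < μ * (1 - μ) := mul_pos h0 (by linarith)
  have hX0 : ∀ f : Fin 2 → ℝ, ∫ ω, f (ω 0) ∂(Measure.infinitePi fun _ : ℕ => attrLaw μ) =
      μ * f 0 + (1 - μ) * f 1 := by
    intro f
    have hf : AEStronglyMeasurable f
        ((Measure.infinitePi fun _ : ℕ => attrLaw μ).map fun ω => ω 0) :=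
      (measurable_of_finite f).aestronglyMeasurable
    rw [← integral_map (measurable_pi_apply 0).aemeasurable hf, Measure.infinitePi_map_eval,
      integral_attrLaw h0.le h1.le f]
  have hclt := tendstoInDistribution_inv_sqrt_mul_sum
    (P := Measure.infinitePi fun _ : ℕ => attrLaw μ) (P' := gaussianReal 0 1)
    (X := fun i ω => standardized μ (ω i)) (Y := id) HasLaw.id
    (by
      rw [hX0]
      simp only [standardized, if_true, one_ne_zero, if_false]
      ring)
    (by
      have := hX0 fun x => standardized μ x ^ 2
      refine this.trans ?_
      simp only [standardized, if_true, one_ne_zero, if_false, div_pow, Real.sq_sqrt hv.le]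
      have : (1 - μ) ≠ 0 := by linarith
      field_simp
      ring)
    (iIndepFun_infinitePi (X := fun _ => standardized μ) fun _ => measurable_of_finite _)
    (fun i => by
      have h : IdentDistrib (fun ω : ℕ → Fin 2 => ω i) (fun ω => ω 0)
          (Measure.infinitePi fun _ : ℕ => attrLaw μ)
          (Measure.infinitePi fun _ : ℕ => attrLaw μ) :=
        ⟨(measurable_pi_apply i).aemeasurable, (measurable_pi_apply 0).aemeasurable, by
          rw [Measure.infinitePi_map_eval, Measure.infinitePi_map_eval]⟩
      exact h.comp (measurable_of_finite (standardized μ)))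
  have hfr : ((gaussianReal 0 1).map id) (frontier (Set.Ici t)) = 0 := by
    rw [Measure.map_id, frontier_Ici]
    exact gaussianReal_absolutelyContinuous 0 one_ne_zero (by simp)
  have h2 := ProbabilityMeasure.tendsto_measure_of_null_frontier_of_tendsto' hclt.tendsto
    (E := Set.Ici t) hfr
  have hfin : (gaussianReal 0 1).map id (Set.Ici t) ≠ ⊤ := by
    rw [Measure.map_id]
    exact measure_ne_top _ _
  have h3 := (ENNReal.tendsto_toReal hfin).comp h2
  have h4 : (gaussianReal 0 1).real (Set.Ici t) =
      ((gaussianReal 0 1).map id (Set.Ici t)).toReal := by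
    rw [Measure.map_id]; rfl
  rw [h4]
  refine h3.congr fun l => ?_
  rw [← infinitePi_attrLaw_cylinder h0.le h1.le]
  simp only [Function.comp_apply, ProbabilityMeasure.coe_mk]
  rw [Measure.map_apply_of_aemeasurable (hclt.forall_aemeasurable l) measurableSet_Ici]
  simp only [Measure.real, Set.preimage, Set.mem_Ici, Finset.sum_range]

theorem goodProb_mono {μ : ℝ} (h0 : 0 ≤ μ) (h1 : μ ≤ 1) {l : ℕ}
    {good good' : (Fin l → Fin 2) → Prop} (h : ∀ b, good b → good' b) :
    goodProb μ good ≤ goodProb μ good' := by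
  refine Finset.sum_le_sum fun b _ => mul_le_mul_of_nonneg_left ?_ (attrProb_nonneg h0 h1 b)
  by_cases hb : good b
  · simp [hb, h b hb]
  · simp only [hb, if_false]
    split_ifs <;> norm_num

/-- The tail of the standard normal distribution. -/
noncomputable def gaussianTail (t : ℝ) : ℝ := (gaussianReal 0 1).real (Set.Ici t)

theorem gaussianTail_eq (t : ℝ) : gaussianTail t = 1 - cdf (gaussianReal 0 1) t := by
  have := nullSingletonClass_gaussianReal (μ := 0) (v := 1) one_ne_zero
  have h2 : NullMeasurableSet (Set.Iic t) (gaussianReal 0 1) := measurableSet_Iic.nullMeasurableSet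
  rw [cdf_eq_real, ← probReal_compl_eq_one_sub₀ h2, Set.compl_Iic]
  exact measureReal_congr Ioi_ae_eq_Ici.symm

theorem tendsto_gaussianTail_atBot : Tendsto gaussianTail atBot (𝓝 1) := by
  rw [funext gaussianTail_eq]
  simpa using (tendsto_cdf_atBot (gaussianReal 0 1)).const_sub 1

theorem tendsto_gaussianTail_atTop : Tendsto gaussianTail atTop (𝓝 0) := by
  rw [funext gaussianTail_eq]
  simpa using (tendsto_cdf_atTop (gaussianReal 0 1)).const_sub 1

theorem continuous_gaussianTail : Continuous gaussianTail := by
  have := nullSingletonClass_gaussianReal (μ := 0) (v := 1) one_ne_zero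
  rw [funext gaussianTail_eq]
  refine continuous_const.sub (continuous_iff_continuousAt.mpr fun t => ?_)
  rw [(cdf (gaussianReal 0 1)).mono.continuousAt_iff_leftLim_eq_rightLim,
    StieltjesFunction.rightLim_eq]
  -- The jump of the distribution function at `t` is the mass of the point `t`, which is 0.
  have h := (cdf (gaussianReal 0 1)).measure_singleton t
  rw [measure_cdf, measure_singleton, eq_comm, ENNReal.ofReal_eq_zero, sub_nonpos] at h
  exact le_antisymm ((cdf (gaussianReal 0 1)).mono.leftLim_le le_rfl) h

theorem gaussianTail_pos (t : ℝ) : 0 < gaussianTail t := by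
  refine ENNReal.toReal_pos (fun h => ?_) (measure_ne_top _ _)
  have := gaussianReal_absolutelyContinuous' 0 one_ne_zero h
  simp at this

variable {μ : ℝ} {l : ℕ → ℕ} {τ : ℕ → ℝ}

/-- A moving threshold is eventually on the known side of any fixed `s ≠ t`; monotonicity and
continuity of the Gaussian tail let `s` be taken close to `t`. -/
theorem tendsto_goodProb_of_tendsto_nhds (h0 : 0 < μ) (h1 : μ < 1) (hl : Tendsto l atTop atTop)
    {t : ℝ} (hτ : Tendsto τ atTop (𝓝 t)) :
    Tendsto (fun n => goodProb μ fun b : Fin (l n) → Fin 2 =>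
      τ n ≤ (√(l n))⁻¹ * ∑ i, standardized μ (b i)) atTop (𝓝 (gaussianTail t)) := by
  refine tendsto_order.mpr ⟨fun x hx => ?_, fun x hx => ?_⟩
  · obtain ⟨s, hs, hst⟩ := ((continuous_gaussianTail.continuousAt.eventually_const_lt
      hx).filter_mono nhdsWithin_le_nhds |>.and (self_mem_nhdsWithin (s := Set.Ioi t))).exists
    filter_upwards [((tendsto_goodProb_standardized h0 h1 s).comp hl).eventually_const_lt hs,
      hτ.eventually_lt_const hst] with n h2 h3
    exact h2.trans_le (goodProb_mono h0.le h1.le fun b hb => h3.le.trans hb)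
  · obtain ⟨s, hs, hst⟩ := ((continuous_gaussianTail.continuousAt.eventually_lt_const
      hx).filter_mono nhdsWithin_le_nhds |>.and (self_mem_nhdsWithin (s := Set.Iio t))).exists
    filter_upwards [((tendsto_goodProb_standardized h0 h1 s).comp hl).eventually_lt_const hs,
      hτ.eventually_const_lt hst] with n h2 h3
    exact (goodProb_mono h0.le h1.le fun b hb => h3.le.trans hb).trans_lt h2

theorem tendsto_goodProb_of_tendsto_atBot (h0 : 0 < μ) (h1 : μ < 1) (hl : Tendsto l atTop atTop)
    (hτ : Tendsto τ atTop atBot) :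
    Tendsto (fun n => goodProb μ fun b : Fin (l n) → Fin 2 =>
      τ n ≤ (√(l n))⁻¹ * ∑ i, standardized μ (b i)) atTop (𝓝 1) := by
  refine tendsto_order.mpr ⟨fun x hx => ?_, fun x hx =>
    Eventually.of_forall fun n => (goodProb_le_one h0.le h1.le _).trans_lt hx⟩
  obtain ⟨s, hs⟩ := (tendsto_gaussianTail_atBot.eventually_const_lt hx).exists
  filter_upwards [((tendsto_goodProb_standardized h0 h1 s).comp hl).eventually_const_lt hs,
    hτ.eventually_le_atBot s] with n h2 h3
  exact h2.trans_le (goodProb_mono h0.le h1.le fun b hb => h3.trans hb)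

theorem tendsto_goodProb_of_tendsto_atTop (h0 : 0 < μ) (h1 : μ < 1) (hl : Tendsto l atTop atTop)
    (hτ : Tendsto τ atTop atTop) :
    Tendsto (fun n => goodProb μ fun b : Fin (l n) → Fin 2 =>
      τ n ≤ (√(l n))⁻¹ * ∑ i, standardized μ (b i)) atTop (𝓝 0) := by
  refine tendsto_order.mpr ⟨fun x hx =>
    Eventually.of_forall fun n => hx.trans_le (goodProb_nonneg h0.le h1.le _), fun x hx => ?_⟩
  obtain ⟨s, hs⟩ := (tendsto_gaussianTail_atTop.eventually_lt_const hx).exists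
  filter_upwards [((tendsto_goodProb_standardized h0 h1 s).comp hl).eventually_lt_const hs,
    hτ.eventually_ge_atTop s] with n h2 h3
  exact (goodProb_mono h0.le h1.le fun b hb => h3.trans hb).trans_lt h2

end CentralLimit

/-! ### Error bounds for fixed `n`. -/

section FiniteBounds

variable {μ : ℝ} {Θ : Matrix (Fin 2) (Fin 2) ℝ} {n l : ℕ} {good bad : (Fin l → Fin 2) → Prop}

theorem pexp_eval {ι α : Type*} [Fintype ι] [DecidableEq ι] [Fintype α] {w : ι → α → ℝ}
    (hw : ∀ i, ∑ a, w i a = 1) (i : ι) (h : α → ℝ) :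
    pexp w (fun f => h (f i)) = ∑ a, w i a * h a := by
  have h1 := pexp_prod w fun j a => if j = i then h a else 1
  have h2 : ∀ f : ι → α, (∏ j, if j = i then h (f j) else 1) = h (f i) := fun f => by
    rw [Finset.prod_ite_eq' Finset.univ i fun j => h (f j), if_pos (Finset.mem_univ i)]
  have h3 : (∏ j, ∑ a, w j a * if j = i then h a else 1) = ∑ a, w i a * h a := by
    rw [Finset.prod_eq_single i]
    · simp
    · intro j _ hj
      simp [hj, hw]
    · simp
  simp only [h2, h3] at h1
  exact h1

theorem div_three_le_card_residue (i : ℕ) (hi : i < 3) :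
    n / 3 ≤ Fintype.card {u : Fin n // u.val % 3 = i} := by
  have h : ∀ k : Fin (n / 3), 3 * k.val + i < n := fun k => by omega
  have := Fintype.card_le_of_injective
    (fun k : Fin (n / 3) => (⟨⟨3 * k.val + i, h k⟩, by simp only; omega⟩ :
      {u : Fin n // u.val % 3 = i}))
    (fun k k' hk => Fin.ext (by simpa using hk))
  simpa using this

theorem div_three_le_card_not_residue (i : ℕ) :
    n / 3 ≤ Fintype.card {u : Fin n // ¬ u.val % 3 = i} := by
  have h : ∀ k : Fin (n / 3), 3 * k.val + (i + 1) % 3 < n := fun k => by omega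
  have := Fintype.card_le_of_injective
    (fun k : Fin (n / 3) => (⟨⟨3 * k.val + (i + 1) % 3, h k⟩, by simp only; omega⟩ :
      {u : Fin n // ¬ u.val % 3 = i}))
    (fun k k' hk => by simpa [Fin.val_inj] using hk)
  simpa using this

open scoped Classical in
/-- With high probability all good nodes lie in one component. -/
theorem expect_good_not_connected_le (hΘ : IsAffinity Θ) (h0 : 0 ≤ μ) (h1 : μ ≤ 1)
    (hgood : ∀ b b', b ≤ b' → good b' → good b) {δ : ℝ} (hδ0 : 0 ≤ δ) (hδ1 : δ ≤ 1)
    (hδ : ∀ b, good b → δ ≤ meanAffinity μ Θ b) (hpos : 0 < goodProb μ good) :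
    expect μ Θ (fun (a : Fin n → Fin l → Fin 2) G =>
      if ∃ u v, good (a u) ∧ good (a v) ∧ ¬ G.Reachable u v then 1 else 0) ≤
      3 * ((1 - δ * goodProb μ good / 8) ^ (n / 3) * n +
        2 / goodProb μ good * (1 - goodProb μ good * δ) ^ (n / 3)) := by
  have hg1 := goodProb_le_one h0 h1 good
  have hδg : δ * goodProb μ good ≤ 1 := mul_le_one₀ hδ1 hpos.le hg1
  have hδg0 : 0 ≤ δ * goodProb μ good := mul_nonneg hδ0 hpos.le
  have hD : ∀ i ∈ Finset.range 3, expect μ Θ (fun (a : Fin n → Fin l → Fin 2) G =>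
      if ∃ u v : Fin n, ¬ u.val % 3 = i ∧ ¬ v.val % 3 = i ∧ good (a u) ∧ good (a v) ∧
        ¬ G.Reachable u v then 1 else 0) ≤ (1 - δ * goodProb μ good / 8) ^ (n / 3) * n +
        2 / goodProb μ good * (1 - goodProb μ good * δ) ^ (n / 3) := by
    intro i hi
    refine (expect_not_reachable_le hΘ h0 h1 hgood hδ0 hδ1 hδ hpos
      (fun u : Fin n => u.val % 3 = i)).trans ?_
    have hc : (Fintype.card {u : Fin n // ¬ u.val % 3 = i} : ℝ) ≤ n := by
      have := Fintype.card_subtype_le fun u : Fin n => ¬ u.val % 3 = i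
      rw [Fintype.card_fin] at this
      exact_mod_cast this
    have hc1 := div_three_le_card_residue (n := n) i (Finset.mem_range.mp hi)
    have hc2 := div_three_le_card_not_residue (n := n) i
    refine add_le_add ?_ (mul_le_mul_of_nonneg_left ?_ (by positivity))
    · exact mul_le_mul (pow_le_pow_of_le_one (by linarith) (by linarith) hc1) hc (by positivity)
        (pow_nonneg (by linarith) _)
    · rw [mul_comm]
      exact pow_le_pow_of_le_one (by linarith) (by linarith) hc2
  have hsum := Finset.sum_le_sum hD
  rw [← expect_sum, Finset.sum_const, Finset.card_range, nsmul_eq_mul] at hsum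
  refine (expect_mono h0 h1 hΘ fun a G => ?_).trans hsum
  have hnn : ∀ i ∈ Finset.range 3, (0 : ℝ) ≤ if ∃ u v : Fin n, ¬ u.val % 3 = i ∧ ¬ v.val % 3 = i ∧
      good (a u) ∧ good (a v) ∧ ¬ G.Reachable u v then 1 else 0 := fun i _ => by
    split_ifs <;> norm_num
  split_ifs with h
  · obtain ⟨u, v, hu, hv, hr⟩ := h
    -- Two nodes occupy at most two of the three residue classes, so a third class can serve as the
    -- reserved set `D` for them.
    obtain ⟨i, hi, hui, hvi⟩ : ∃ i < 3, ¬ u.val % 3 = i ∧ ¬ v.val % 3 = i := by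
      by_cases h0 : u.val % 3 = 0 ∨ v.val % 3 = 0
      · by_cases h1 : u.val % 3 = 1 ∨ v.val % 3 = 1
        · exact ⟨2, by omega, by omega, by omega⟩
        · exact ⟨1, by omega, by omega, by omega⟩
      · exact ⟨0, by omega, by omega, by omega⟩
    refine le_trans (le_of_eq ?_) (Finset.single_le_sum hnn (Finset.mem_range.mpr hi))
    rw [if_pos ⟨u, v, hui, hvi, hu, hv, hr⟩]
  · exact Finset.sum_nonneg hnn

open scoped Classical in
/-- With high probability there are linearly many good nodes. -/
theorem expect_few_good_le (h0 : 0 ≤ μ) (h1 : μ ≤ 1) (hΘ : IsAffinity Θ) (c : ℝ) :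
    expect μ Θ (fun (a : Fin n → Fin l → Fin 2) _ =>
      if ((Finset.univ.filter fun u => good (a u)).card : ℝ) ≤ c * n then 1 else 0) ≤
      ((2 : ℝ) ^ c * (1 - goodProb μ good / 2)) ^ n := by
  -- Exponential Markov inequality: weight `1/2` per good node gives the expectation of `2 ^
  -- (-#good)`.
  have hp := pexp_prod (fun _ : Fin n => attrProb μ (l := l))
    fun _ b => if good b then (1 / 2 : ℝ) else 1
  have h2 : ∑ b, attrProb μ b * (if good b then (1 / 2 : ℝ) else 1) = 1 - goodProb μ good / 2 := by
    have : ∀ b : Fin l → Fin 2, attrProb μ b * (if good b then (1 / 2 : ℝ) else 1) =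
        attrProb μ b - (attrProb μ b * if good b then 1 else 0) / 2 := fun b => by
      split_ifs <;> ring
    simp only [this, Finset.sum_sub_distrib, sum_attrProb, goodProb, Finset.sum_div]
  simp only [h2, Finset.prod_const, Finset.card_univ, Fintype.card_fin] at hp
  rw [mul_pow, ← hp, ← expect_attr (Θ := Θ), ← expect_const_mul]
  refine expect_mono h0 h1 hΘ fun a G => ?_
  rw [Finset.prod_ite, Finset.prod_const, Finset.prod_const_one, mul_one]
  split_ifs with h
  · rw [← Real.rpow_natCast, ← Real.rpow_mul (by norm_num), ← Real.rpow_natCast, one_div,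
      Real.inv_rpow (by norm_num), ← Real.rpow_neg (by norm_num), ← Real.rpow_add (by norm_num)]
    exact Real.one_le_rpow (by norm_num) (by linarith)
  · positivity

open scoped Classical in
/-- The nodes that are not good, and are not both bad and isolated. -/
noncomputable def exceptional (good bad : (Fin l → Fin 2) → Prop) (a : Fin n → Fin l → Fin 2)
    (G : SimpleGraph (Fin n)) : Finset (Fin n) :=
  Finset.univ.filter fun u => ¬ good (a u) ∧ (¬ bad (a u) ∨ ∃ v, G.Adj u v)

theorem mem_exceptional {a : Fin n → Fin l → Fin 2} {G : SimpleGraph (Fin n)} {u : Fin n} :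
    u ∈ exceptional good bad a G ↔ ¬ good (a u) ∧ (¬ bad (a u) ∨ ∃ v, G.Adj u v) := by
  simp [exceptional]

open scoped Classical in
-- Reserve every node except `u`: given the attributes of `u`, each of the others is joined to it
-- with probability `meanAffinity`, and a union bound over them applies.
theorem expect_bad_not_isolated_le (h0 : 0 ≤ μ) (h1 : μ ≤ 1) (hΘ : IsAffinity Θ) {η : ℝ}
    (hη : 0 ≤ η) (hbad : ∀ b, bad b → n * meanAffinity μ Θ b ≤ η) (u : Fin n) :
    expect μ Θ (fun (a : Fin n → Fin l → Fin 2) G =>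
      if bad (a u) ∧ ∃ v, G.Adj u v then 1 else 0) ≤ η := by
  let y : {v : Fin n // ¬ v ≠ u} := ⟨u, fun h => h rfl⟩
  have hb := expect_bipartite (μ := μ) hΘ (fun v : Fin n => v ≠ u)
    fun (c : {v // ¬ v ≠ u} → Fin l → Fin 2) T => if bad (c y) then
      ∑ x, if T x y then (1 : ℝ) else 0 else 0
  refine (expect_mono h0 h1 hΘ fun a G => ?_).trans (hb.le.trans ?_)
  · by_cases h : bad (a u)
    · have hnn : ∀ x ∈ (Finset.univ : Finset {v : Fin n // v ≠ u}),
          (0 : ℝ) ≤ if G.Adj x.1 u then 1 else 0 := fun x _ => by split_ifs <;> norm_num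
      simp only [h, true_and, if_true, y]
      split_ifs with hv
      · obtain ⟨v, hv⟩ := hv
        refine le_trans (le_of_eq ?_)
          (Finset.single_le_sum hnn (Finset.mem_univ ⟨v, hv.ne'⟩))
        rw [if_pos hv.symm]
      · exact Finset.sum_nonneg hnn
    · simp [h, y]
  · refine (pexp_mono (G := fun _ => η) (fun _ => attrProb_nonneg h0 h1) fun c => ?_).trans
      (pexp_const (fun _ => sum_attrProb) η).le
    by_cases h : bad (c y)
    · simp only [h, if_true]
      rw [pexp_sum]
      have hx : ∀ x : {v : Fin n // v ≠ u}, pexp (fun _ : {v : Fin n // v ≠ u} => nbhdProb μ Θ c)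
          (fun T => if T x y then (1 : ℝ) else 0) = meanAffinity μ Θ (c y) := by
        intro x
        rw [pexp_eval (fun _ => sum_nbhdProb) x fun t => if t y then (1 : ℝ) else 0,
          sum_nbhdProb_mul]
        unfold meanAffinity
        refine Finset.sum_congr rfl fun b _ => ?_
        rw [pexp_eval (fun _ => sum_bern _) y fun x => if x then (1 : ℝ) else 0,
          hΘ.affinity_comm (c y)]
        simp [bern]
      simp only [hx, Finset.sum_const, nsmul_eq_mul, Finset.card_univ]
      refine le_trans (mul_le_mul_of_nonneg_right ?_ ?_) (hbad _ h)
      · have := Fintype.card_subtype_le fun v : Fin n => v ≠ u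
        rw [Fintype.card_fin] at this
        exact_mod_cast this
      · exact Finset.sum_nonneg fun b _ =>
          mul_nonneg (attrProb_nonneg h0 h1 b) (hΘ.affinity_nonneg _ _)
    · simp only [h, if_false]
      rw [pexp_const (fun _ => sum_nbhdProb)]
      exact hη

open scoped Classical in
/-- With high probability there are few exceptional nodes. -/
theorem expect_many_exceptional_le (h0 : 0 ≤ μ) (h1 : μ ≤ 1) (hΘ : IsAffinity Θ) {η ε : ℝ}
    (hη : 0 ≤ η) (hε : 0 < ε) (hn : 0 < n)
    (hbad : ∀ b, bad b → n * meanAffinity μ Θ b ≤ η) :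
    expect μ Θ (fun (a : Fin n → Fin l → Fin 2) G =>
      if ε * n < (exceptional good bad a G).card then 1 else 0) ≤
      (goodProb μ (fun b => ¬ good b ∧ ¬ bad b) + η) / ε := by
  have hn' : (0 : ℝ) < n := by exact_mod_cast hn
  have h2 : ∀ u : Fin n, expect μ Θ (fun (a : Fin n → Fin l → Fin 2) G =>
      (if ¬ good (a u) ∧ ¬ bad (a u) then (1 : ℝ) else 0) +
        if bad (a u) ∧ ∃ v, G.Adj u v then 1 else 0) ≤
      goodProb μ (fun b => ¬ good b ∧ ¬ bad b) + η := by
    intro u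
    rw [expect_add, expect_attr]
    refine add_le_add (le_of_eq ?_) (expect_bad_not_isolated_le h0 h1 hΘ hη hbad u)
    refine (pexp_eval (fun _ => sum_attrProb) u
      fun b => if ¬ good b ∧ ¬ bad b then (1 : ℝ) else 0).trans ?_
    unfold goodProb
    exact Finset.sum_congr rfl fun b _ => by congr
  have h3 := Finset.sum_le_sum fun u (_ : u ∈ Finset.univ) => h2 u
  rw [← expect_sum, Finset.sum_const, Finset.card_univ, Fintype.card_fin, nsmul_eq_mul] at h3
  have h4 := mul_le_mul_of_nonneg_left h3 (by positivity : 0 ≤ 1 / (ε * n))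
  rw [← expect_const_mul] at h4
  refine (expect_mono h0 h1 hΘ fun a G => ?_).trans (h4.trans (le_of_eq (by field_simp)))
  have h5 : ((exceptional good bad a G).card : ℝ) ≤
      ∑ u, ((if ¬ good (a u) ∧ ¬ bad (a u) then (1 : ℝ) else 0) +
        if bad (a u) ∧ ∃ v, G.Adj u v then 1 else 0) := by
    rw [exceptional, ← Finset.sum_boole]
    refine Finset.sum_le_sum fun u _ => ?_
    by_cases hg : good (a u) <;> by_cases hb : bad (a u) <;> by_cases hv : ∃ v, G.Adj u v <;>
      simp [hg, hb, hv]
  have h6 : (0 : ℝ) ≤ (exceptional good bad a G).card := by positivity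
  split_ifs with h
  · rw [one_div, ← div_eq_inv_mul, le_div_iff₀ (by positivity)]
    linarith
  · exact mul_nonneg (by positivity) (h6.trans h5)

/-- A component with at least two nodes has no isolated node. -/
theorem ncard_supp_le {G : SimpleGraph (Fin n)} (C : G.ConnectedComponent) (S : Finset (Fin n))
    (h : ∀ u ∈ C.supp, (∃ v, G.Adj u v) → u ∈ S) : C.supp.ncard ≤ max 1 S.card := by
  by_cases hC : C.supp.ncard ≤ 1
  · exact hC.trans (le_max_left _ _)
  · refine le_trans ?_ (le_max_right _ _)
    rw [← Set.ncard_coe_finset]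
    refine Set.ncard_le_ncard (fun u hu => h u hu ?_) (Set.toFinite _)
    obtain ⟨v, hv, hne⟩ := Set.exists_ne_of_one_lt_ncard (not_le.mp hC) u
    have hr : G.Reachable u v := SimpleGraph.ConnectedComponent.exact
      ((SimpleGraph.ConnectedComponent.mem_supp_iff _ _).mp hu |>.trans
        ((SimpleGraph.ConnectedComponent.mem_supp_iff _ _).mp hv).symm)
    obtain ⟨p⟩ := hr
    cases p with
    | nil => exact absurd rfl hne
    | cons hadj _ => exact ⟨_, hadj⟩

/-- If every outcome outside `E` is accounted for by `F`, then `E` has probability at least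
`1 - expect F`. -/
theorem one_sub_expect_le_prob (h0 : 0 ≤ μ) (h1 : μ ≤ 1) (hΘ : IsAffinity Θ)
    {E : Set (SimpleGraph (Fin n))} {F : (Fin n → Fin l → Fin 2) → SimpleGraph (Fin n) → ℝ}
    (hF0 : ∀ a G, 0 ≤ F a G) (hF : ∀ a G, G ∉ E → 1 ≤ F a G) :
    1 - expect μ Θ F ≤ prob n l μ Θ E := by
  classical
  rw [sub_le_iff_le_add, prob_eq_expect, ← expect_add]
  refine (expect_const (μ := μ) (Θ := Θ) (n := n) (l := l) 1).symm.le.trans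
    (expect_mono h0 h1 hΘ fun a G => ?_)
  split_ifs with h
  · linarith [hF0 a G]
  · linarith [hF a G h]

theorem prob_mono (h0 : 0 ≤ μ) (h1 : μ ≤ 1) (hΘ : IsAffinity Θ)
    {E E' : Set (SimpleGraph (Fin n))} (h : E ⊆ E') : prob n l μ Θ E ≤ prob n l μ Θ E' := by
  classical
  rw [prob_eq_expect, prob_eq_expect]
  refine expect_mono h0 h1 hΘ fun a G => ?_
  by_cases hG : G ∈ E
  · simp [hG, h hG]
  · simp only [hG, if_false]
    split_ifs <;> norm_num

theorem prob_le_one (h0 : 0 ≤ μ) (h1 : μ ≤ 1) (hΘ : IsAffinity Θ)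
    (E : Set (SimpleGraph (Fin n))) : prob n l μ Θ E ≤ 1 := by
  rw [← prob_univ n l μ Θ]
  exact prob_mono h0 h1 hΘ (Set.subset_univ E)

open scoped Classical in
/-- A lower bound for the probability of a unique giant component. -/
theorem one_sub_le_prob_unique_giant (h0 : 0 ≤ μ) (h1 : μ ≤ 1) (hΘ : IsAffinity Θ)
    (hgood : ∀ b b', b ≤ b' → good b' → good b) {δ η ε c : ℝ} (hδ0 : 0 ≤ δ) (hδ1 : δ ≤ 1)
    (hδ : ∀ b, good b → δ ≤ meanAffinity μ Θ b) (hpos : 0 < goodProb μ good)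
    (hη : 0 ≤ η) (hε : 0 < ε) (hc : 0 ≤ c) (hn : 0 < n) (hεn : 1 ≤ ε * n)
    (hbad : ∀ b, bad b → n * meanAffinity μ Θ b ≤ η) :
    1 - (3 * ((1 - δ * goodProb μ good / 8) ^ (n / 3) * n +
        2 / goodProb μ good * (1 - goodProb μ good * δ) ^ (n / 3)) +
      (((2 : ℝ) ^ c * (1 - goodProb μ good / 2)) ^ n +
        (goodProb μ (fun b => ¬ good b ∧ ¬ bad b) + η) / ε)) ≤
      prob n l μ Θ {G | ∃ C : G.ConnectedComponent, c * n ≤ (C.supp.ncard : ℝ) ∧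
        ∀ C' : G.ConnectedComponent, C' ≠ C → (C'.supp.ncard : ℝ) ≤ ε * n} := by
  have hA := expect_good_not_connected_le (n := n) hΘ h0 h1 hgood hδ0 hδ1 hδ hpos
  have hB := expect_few_good_le (n := n) (good := good) h0 h1 hΘ c
  have hC := expect_many_exceptional_le (good := good) h0 h1 hΘ hη hε hn hbad
  have hsum := add_le_add hA (add_le_add hB hC)
  rw [← expect_add, ← expect_add] at hsum
  refine (sub_le_sub_left hsum 1).trans (one_sub_expect_le_prob h0 h1 hΘ (fun a G => ?_)
    fun a G hG => ?_)
  · split_ifs <;> norm_num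
  · by_contra hlt
    have hnA : ¬ ∃ u v, good (a u) ∧ good (a v) ∧ ¬ G.Reachable u v := fun h => hlt (by
      rw [if_pos h]
      split_ifs <;> norm_num)
    have hnB : ¬ ((Finset.univ.filter fun u => good (a u)).card : ℝ) ≤ c * n := fun h => hlt (by
      rw [if_pos h]
      split_ifs <;> norm_num)
    have hnC : ¬ ε * n < (exceptional good bad a G).card := fun h => hlt (by
      rw [if_pos h]
      split_ifs <;> norm_num)
    push Not at hnA hnB hnC
    have hne : (Finset.univ.filter fun u => good (a u)).Nonempty := by
      rw [← Finset.card_pos]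
      have : (0 : ℝ) < (Finset.univ.filter fun u => good (a u)).card :=
        lt_of_le_of_lt (by positivity) hnB
      exact_mod_cast this
    obtain ⟨u, hu⟩ := hne
    have hu' := (Finset.mem_filter.mp hu).2
    refine hG ⟨G.connectedComponentMk u, hnB.le.trans ?_, fun C' hC' => ?_⟩
    · rw [← Set.ncard_coe_finset]
      refine Nat.cast_le.mpr (Set.ncard_le_ncard (fun v hv => ?_) (Set.toFinite _))
      have hv' := (Finset.mem_filter.mp (Finset.mem_coe.mp hv)).2
      exact (SimpleGraph.ConnectedComponent.mem_supp_iff _ _).mpr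
        (SimpleGraph.ConnectedComponent.sound (hnA v u hv' hu'))
    -- A good node of `C'` would be connected to `u`, so all non-isolated nodes of `C'` are
    -- exceptional. A singleton component is covered by `1 ≤ ε * n`.
    · have h2 := ncard_supp_le C' (exceptional good bad a G) fun v hv hadj => by
        refine mem_exceptional.mpr ⟨fun hgv => hC' ?_, Or.inr hadj⟩
        rw [← (SimpleGraph.ConnectedComponent.mem_supp_iff _ _).mp hv]
        exact SimpleGraph.ConnectedComponent.sound (hnA v u hgv hu')
      have h3 : (C'.supp.ncard : ℝ) ≤ max 1 ((exceptional good bad a G).card : ℝ) := by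
        exact_mod_cast h2
      exact h3.trans (max_le hεn hnC)

open scoped Classical in
/-- A lower bound for the probability that there is no giant component. -/
theorem one_sub_le_prob_no_giant (h0 : 0 ≤ μ) (h1 : μ ≤ 1) (hΘ : IsAffinity Θ) {η ε : ℝ}
    (hη : 0 ≤ η) (hε : 0 < ε) (hn : 0 < n) (hεn : 1 ≤ ε * n)
    (hbad : ∀ b, bad b → n * meanAffinity μ Θ b ≤ η) :
    1 - (goodProb μ (fun b => ¬ bad b) + η) / ε ≤
      prob n l μ Θ {G | ∀ C : G.ConnectedComponent, (C.supp.ncard : ℝ) ≤ ε * n} := by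
  -- With no good nodes, every non-isolated node is exceptional.
  have hC := expect_many_exceptional_le (good := fun _ => False) h0 h1 hΘ hη hε hn hbad
  simp only [not_false_eq_true, true_and] at hC
  refine (sub_le_sub_left hC 1).trans (one_sub_expect_le_prob h0 h1 hΘ (fun a G => ?_)
    fun a G hG => ?_)
  · split_ifs <;> norm_num
  · by_contra hlt
    have hnC : ¬ ε * n < (exceptional (fun _ => False) bad a G).card := fun h => hlt (by
      rw [if_pos h])
    push Not at hnC
    refine hG fun C => ?_
    have h2 := ncard_supp_le C (exceptional (fun _ => False) bad a G) fun v hv hadj =>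
      mem_exceptional.mpr ⟨fun h => h, Or.inr hadj⟩
    have h3 : (C.supp.ncard : ℝ) ≤ max 1 ((exceptional (fun _ => False) bad a G).card : ℝ) := by
      exact_mod_cast h2
    exact h3.trans (max_le hεn hnC)

/-- For `n > 0` a component of size `c n` excludes that all have size at most `c n / 2`, so the two
probabilities cannot both tend to 1. -/
theorem not_uniqueGiantWHP_of_noGiantWHP (h0 : 0 ≤ μ) (h1 : μ ≤ 1) (hΘ : IsAffinity Θ)
    {l : ℕ → ℕ} (h : NoGiantWHP l μ Θ) : ¬ UniqueGiantWHP l μ Θ := by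
  rintro ⟨c, hc, hU⟩
  have h2 := (hU 1 one_pos).add (h (c / 2) (half_pos hc))
  have h3 := (h2.eventually_const_lt (by norm_num : (1 : ℝ) < 1 + 1)).and (eventually_gt_atTop 0)
  obtain ⟨n, hn, hn0⟩ := h3.exists
  classical
  rw [prob_eq_expect, prob_eq_expect, ← expect_add] at hn
  refine absurd ((expect_mono h0 h1 hΘ fun a G => ?_).trans
    (expect_const (μ := μ) (Θ := Θ) (n := n) (l := l n) 1).le) (not_le.mpr hn)
  have hn' : (0 : ℝ) < n := by exact_mod_cast hn0
  simp only [Set.mem_ofPred_eq]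
  split_ifs with hA hB
  · obtain ⟨C, hC, _⟩ := hA
    have := hB C
    have := mul_pos hc hn'
    linarith
  all_goals norm_num

end FiniteBounds

/-! ### The expected degree on the logarithmic scale. -/

section Thresholds

variable {μ : ℝ} {Θ : Matrix (Fin 2) (Fin 2) ℝ}

theorem IsAffinity.meanAffinity_anti (hΘ : IsAffinity Θ) (h0 : 0 ≤ μ) (h1 : μ ≤ 1) {l : ℕ} :
    Antitone (meanAffinity μ Θ : (Fin l → Fin 2) → ℝ) := fun _ _ h =>
  Finset.sum_le_sum fun c _ =>
    mul_le_mul_of_nonneg_left (hΘ.affinity_anti_left c h) (attrProb_nonneg h0 h1 c)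

/-- Each attribute contributes `log A` or `log B`, a variable with mean `μ log A + (1-μ) log B` and
standard deviation `√(μ(1-μ)) (log A - log B)`. -/
theorem meanAffinity_eq_exp (h0 : 0 < μ) (h1 : μ < 1) {A B : ℝ} (hA : 0 < A) (hB : 0 < B)
    (hΘA : μ * Θ 0 0 + (1 - μ) * Θ 0 1 = A) (hΘB : μ * Θ 1 0 + (1 - μ) * Θ 1 1 = B) {l : ℕ}
    (b : Fin l → Fin 2) :
    meanAffinity μ Θ b = Real.exp (l * (μ * Real.log A + (1 - μ) * Real.log B) +
      √(μ * (1 - μ)) * (Real.log A - Real.log B) * ∑ i, standardized μ (b i)) := by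
  have hv : √(μ * (1 - μ)) ≠ 0 := (Real.sqrt_pos.mpr (mul_pos h0 (by linarith))).ne'
  have hx : ∀ x : Fin 2, μ * Θ x 0 + (1 - μ) * Θ x 1 =
      Real.exp ((μ * Real.log A + (1 - μ) * Real.log B) +
        √(μ * (1 - μ)) * (Real.log A - Real.log B) * standardized μ x) := by
    intro x
    fin_cases x
    · have : (μ * Real.log A + (1 - μ) * Real.log B) +
          √(μ * (1 - μ)) * (Real.log A - Real.log B) * standardized μ 0 = Real.log A := by
        simp only [standardized, if_true]
        field_simp
        ring
      simp only [Fin.zero_eta, this, Real.exp_log hA, hΘA]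
    · have : (μ * Real.log A + (1 - μ) * Real.log B) +
          √(μ * (1 - μ)) * (Real.log A - Real.log B) * standardized μ 1 = Real.log B := by
        simp only [standardized, one_ne_zero, if_false]
        field_simp
        ring
      simp only [Fin.mk_one, this, Real.exp_log hB, hΘB]
  rw [meanAffinity_eq]
  simp only [hx]
  rw [← Real.exp_sum, Finset.sum_add_distrib, Finset.sum_const, Finset.card_univ, Fintype.card_fin,
    nsmul_eq_mul, ← Finset.mul_sum]

theorem threshold_iff {l n : ℕ} (hl : 0 < l) (hn : 0 < n) {θ σ m M S : ℝ} (hθ : 0 < θ)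
    (hσ : 0 < σ) (hM : M = Real.exp (l * m + σ * S)) :
    θ ≤ n * M ↔ (Real.log θ - Real.log n - l * m) / (σ * √l) ≤ (√l)⁻¹ * S := by
  have hn' : (0 : ℝ) < n := by exact_mod_cast hn
  have hl' : (0 : ℝ) < √l := Real.sqrt_pos.mpr (by exact_mod_cast hl)
  have h1 : (n : ℝ) * M = Real.exp (Real.log n + (l * m + σ * S)) := by
    rw [Real.exp_add, Real.exp_log hn', hM]
  rw [h1, ← Real.log_le_iff_le_exp hθ, div_le_iff₀ (mul_pos hσ hl')]
  have h2 : (√l)⁻¹ * S * (σ * √l) = σ * S := by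
    field_simp
  rw [h2]
  constructor <;> intro h <;> linarith

/-- The limiting probability that the expected degree of a node passes a threshold that is
a power of `log n`, in terms of the exponent of the typical expected degree. -/
noncomputable def limitTail (κ : ℝ) : ℝ :=
  if 0 < κ then 1 else if κ = 0 then gaussianTail 0 else 0

theorem limitTail_pos {κ : ℝ} (h : 0 ≤ κ) : 0 < limitTail κ := by
  unfold limitTail
  split_ifs with h1 h2
  · exact one_pos
  · exact gaussianTail_pos 0
  · exact absurd (le_antisymm (not_lt.mp h1) h) h2

theorem limitTail_of_neg {κ : ℝ} (h : κ < 0) : limitTail κ = 0 := by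
  unfold limitTail
  rw [if_neg (not_lt.mpr h.le), if_neg h.ne]

variable {ρ : ℝ} {l : ℕ → ℕ}

theorem tendsto_log_natCast_atTop : Tendsto (fun n : ℕ => Real.log n) atTop atTop :=
  Real.tendsto_log_atTop.comp tendsto_natCast_atTop_atTop

theorem tendsto_rank_div_log (hl : ∀ n : ℕ, 1 ≤ n → |(l n : ℝ) - ρ * Real.logb 2 n| < 1) :
    Tendsto (fun n : ℕ => (l n : ℝ) / Real.log n) atTop (𝓝 (ρ / Real.log 2)) := by
  have h1 : Tendsto (fun n : ℕ => (Real.log n)⁻¹) atTop (𝓝 0) :=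
    tendsto_inv_atTop_zero.comp tendsto_log_natCast_atTop
  have h2 : Tendsto (fun n : ℕ => (l n : ℝ) / Real.log n - ρ / Real.log 2) atTop (𝓝 0) := by
    refine squeeze_zero_norm' ?_ h1
    filter_upwards [tendsto_log_natCast_atTop.eventually_gt_atTop 0, eventually_ge_atTop 1]
      with n hn h1n
    have h3 : (l n : ℝ) / Real.log n - ρ / Real.log 2 =
        ((l n : ℝ) - ρ * Real.logb 2 n) / Real.log n := by
      unfold Real.logb
      field_simp
    rw [h3, norm_div, Real.norm_eq_abs, Real.norm_eq_abs, abs_of_pos hn, ← one_div]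
    exact div_le_div_of_nonneg_right (hl n h1n).le hn.le
  simpa using h2.add_const (ρ / Real.log 2)

theorem tendsto_rank_atTop (hρ : 0 < ρ)
    (hl : ∀ n : ℕ, 1 ≤ n → |(l n : ℝ) - ρ * Real.logb 2 n| < 1) : Tendsto l atTop atTop := by
  have h1 := (tendsto_rank_div_log hl).pos_mul_atTop (div_pos hρ (Real.log_pos one_lt_two))
    tendsto_log_natCast_atTop
  refine tendsto_natCast_atTop_iff.mp (h1.congr' ?_)
  filter_upwards [tendsto_log_natCast_atTop.eventually_gt_atTop 0] with n hn
  field_simp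

/-- The exponent `k` contributes only `k log log n` and the rounding of `l n` only a bounded term.
Both are `o(√(log n))` and are collected in `u`, so neither affects the limit, even when the main
coefficient vanishes. -/
theorem tendsto_standardized_threshold (hρ : 0 < ρ)
    (hl : ∀ n : ℕ, 1 ≤ n → |(l n : ℝ) - ρ * Real.logb 2 n| < 1) (k m : ℝ) :
    ∃ u w : ℕ → ℝ, Tendsto u atTop (𝓝 0) ∧ Tendsto w atTop (𝓝 (√(ρ / Real.log 2))⁻¹) ∧
      ∀ᶠ n : ℕ in atTop, (Real.log (Real.log n ^ k) - Real.log n - l n * m) / √(l n) =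
        (-(1 + ρ * m / Real.log 2) * √(Real.log n) + u n) * w n := by
  have hlog := tendsto_log_natCast_atTop
  have hsq : Tendsto (fun n : ℕ => √(Real.log n)) atTop atTop :=
    Real.tendsto_sqrt_atTop.comp hlog
  refine ⟨fun n => k * (Real.log (Real.log n) / √(Real.log n)) -
      ((l n : ℝ) - ρ * Real.logb 2 n) * m / √(Real.log n),
    fun n => (√((l n : ℝ) / Real.log n))⁻¹, ?_, ?_, ?_⟩
  · have h1 : Tendsto (fun n : ℕ => Real.log (Real.log n) / √(Real.log n)) atTop (𝓝 0) := by
      have := (isLittleO_log_rpow_atTop (by norm_num : (0 : ℝ) < 1 / 2)).tendsto_div_nhds_zero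
      refine (this.comp hlog).congr fun n => ?_
      simp only [Function.comp_apply, Real.sqrt_eq_rpow]
    have h2 : Tendsto (fun n : ℕ => ((l n : ℝ) - ρ * Real.logb 2 n) * m / √(Real.log n))
        atTop (𝓝 0) := by
      refine squeeze_zero_norm' ?_ ((tendsto_const_nhds (x := |m|)).div_atTop hsq)
      filter_upwards [eventually_ge_atTop 1] with n hn
      rw [norm_div, norm_mul, Real.norm_eq_abs, Real.norm_eq_abs, Real.norm_eq_abs,
        abs_of_nonneg (Real.sqrt_nonneg _)]
      exact div_le_div_of_nonneg_right (mul_le_of_le_one_left (abs_nonneg m) (hl n hn).le)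
        (Real.sqrt_nonneg _)
    simpa using (h1.const_mul k).sub h2
  · exact ((tendsto_rank_div_log hl).sqrt).inv₀
      (Real.sqrt_pos.mpr (div_pos hρ (Real.log_pos one_lt_two))).ne'
  · filter_upwards [hlog.eventually_gt_atTop 0,
      (tendsto_rank_atTop hρ hl).eventually_gt_atTop 0] with n hn hln
    have hln' : (0 : ℝ) < l n := by exact_mod_cast hln
    have h2 : Real.log 2 ≠ 0 := (Real.log_pos one_lt_two).ne'
    have hs : √(Real.log n) ≠ 0 := (Real.sqrt_pos.mpr hn).ne'
    have hs' : √(l n : ℝ) ≠ 0 := (Real.sqrt_pos.mpr hln').ne'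
    have hss : √(Real.log n) * √(Real.log n) = Real.log n := Real.mul_self_sqrt hn.le
    rw [Real.log_rpow hn, Real.sqrt_div hln'.le, inv_div, mul_div_assoc', div_left_inj' hs',
      add_mul, sub_mul, mul_assoc, hss, mul_assoc, div_mul_cancel₀ _ hs, div_mul_cancel₀ _ hs]
    unfold Real.logb
    field_simp
    ring

theorem tendsto_goodProb_threshold (h0 : 0 < μ) (h1 : μ < 1) {A B : ℝ} (hB : 0 < B) (hBA : B < A)
    (hΘA : μ * Θ 0 0 + (1 - μ) * Θ 0 1 = A) (hΘB : μ * Θ 1 0 + (1 - μ) * Θ 1 1 = B)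
    (hρ : 0 < ρ) (hl : ∀ n : ℕ, 1 ≤ n → |(l n : ℝ) - ρ * Real.logb 2 n| < 1) (k : ℝ) :
    Tendsto (fun n : ℕ => goodProb μ fun b : Fin (l n) → Fin 2 =>
      Real.log n ^ k ≤ n * meanAffinity μ Θ b) atTop
      (𝓝 (limitTail (1 + ρ * (μ * Real.log A + (1 - μ) * Real.log B) / Real.log 2))) := by
  set m := μ * Real.log A + (1 - μ) * Real.log B with hm
  set κ := 1 + ρ * m / Real.log 2 with hκ
  set σ := √(μ * (1 - μ)) * (Real.log A - Real.log B) with hσ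
  have hσ0 : 0 < σ := mul_pos (Real.sqrt_pos.mpr (mul_pos h0 (by linarith)))
    (sub_pos.mpr (Real.log_lt_log hB hBA))
  have hlt := tendsto_rank_atTop hρ hl
  have hsq : Tendsto (fun n : ℕ => √(Real.log n)) atTop atTop :=
    Real.tendsto_sqrt_atTop.comp tendsto_log_natCast_atTop
  let τ : ℕ → ℝ := fun n => (Real.log (Real.log n ^ k) - Real.log n - l n * m) / (σ * √(l n))
  have hcongr : (fun n : ℕ => goodProb μ fun b : Fin (l n) → Fin 2 =>
      τ n ≤ (√(l n))⁻¹ * ∑ i, standardized μ (b i)) =ᶠ[atTop]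
      (fun n : ℕ => goodProb μ fun b : Fin (l n) → Fin 2 =>
        Real.log n ^ k ≤ n * meanAffinity μ Θ b) := by
    filter_upwards [eventually_gt_atTop 0, hlt.eventually_gt_atTop 0,
      tendsto_log_natCast_atTop.eventually_gt_atTop 0] with n hn hln hlog
    congr 1
    funext b
    exact propext (threshold_iff hln hn (Real.rpow_pos_of_pos hlog k) hσ0
      (meanAffinity_eq_exp h0 h1 (hB.trans hBA) hB hΘA hΘB b)).symm
  refine Tendsto.congr' hcongr ?_
  obtain ⟨u, w, hu, hw, huw⟩ := tendsto_standardized_threshold hρ hl k m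
  have hτ : (fun n : ℕ => ((-κ * √(Real.log n) + u n) * w n) / σ) =ᶠ[atTop] τ := by
    filter_upwards [huw] with n hn
    rw [← hn, div_div, mul_comm (√(l n : ℝ))]
  have hw0 : 0 < (√(ρ / Real.log 2))⁻¹ :=
    inv_pos.mpr (Real.sqrt_pos.mpr (div_pos hρ (Real.log_pos one_lt_two)))
  unfold limitTail
  split_ifs with h2 h3
  -- The sign of `κ` decides whether the standardized threshold tends to `-∞`, `0` or `∞`.
  · refine tendsto_goodProb_of_tendsto_atBot h0 h1 hlt (Tendsto.congr' hτ ?_)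
    refine Tendsto.atBot_div_const hσ0 (Tendsto.atBot_mul_pos hw0 ?_ hw)
    exact (hsq.const_mul_atTop_of_neg (neg_lt_zero.mpr h2)).atBot_add hu
  · refine tendsto_goodProb_of_tendsto_nhds h0 h1 hlt (Tendsto.congr' hτ ?_)
    simp only [h3, neg_zero, zero_mul, zero_add]
    simpa using (hu.mul hw).div_const σ
  · have h4 : κ < 0 := lt_of_le_of_ne (not_lt.mp h2) h3
    refine tendsto_goodProb_of_tendsto_atTop h0 h1 hlt (Tendsto.congr' hτ ?_)
    refine Tendsto.atTop_div_const hσ0 (Tendsto.atTop_mul_pos hw0 ?_ hw)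
    exact (hsq.const_mul_atTop (neg_pos.mpr h4)).atTop_add hu

end Thresholds

/-! ### Letting `n` tend to infinity. -/

section Main

variable {μ : ℝ} {Θ : Matrix (Fin 2) (Fin 2) ℝ} {l : ℕ → ℕ}

theorem noGiantWHP_of_tendsto (h0 : 0 ≤ μ) (h1 : μ ≤ 1) (hΘ : IsAffinity Θ)
    (h : Tendsto (fun n : ℕ => goodProb μ fun b : Fin (l n) → Fin 2 =>
      Real.log n ^ (-1 : ℝ) ≤ n * meanAffinity μ Θ b) atTop (𝓝 0)) : NoGiantWHP l μ Θ := by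
  intro ε hε
  have hη : Tendsto (fun n : ℕ => Real.log n ^ (-1 : ℝ)) atTop (𝓝 0) :=
    (tendsto_rpow_neg_atTop one_pos).comp tendsto_log_natCast_atTop
  have hlow : Tendsto (fun n : ℕ => 1 - (goodProb μ (fun b : Fin (l n) → Fin 2 =>
      Real.log n ^ (-1 : ℝ) ≤ n * meanAffinity μ Θ b) + Real.log n ^ (-1 : ℝ)) / ε)
      atTop (𝓝 1) := by
    simpa using ((h.add hη).div_const ε).const_sub 1
  refine tendsto_of_tendsto_of_tendsto_of_le_of_le' hlow tendsto_const_nhds ?_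
    (Eventually.of_forall fun n => prob_le_one h0 h1 hΘ _)
  filter_upwards [eventually_gt_atTop 0, tendsto_log_natCast_atTop.eventually_gt_atTop 0,
    (tendsto_natCast_atTop_atTop.const_mul_atTop hε).eventually_ge_atTop 1] with n hn hlog hεn
  have := one_sub_le_prob_no_giant (n := n) (bad := fun b : Fin (l n) → Fin 2 =>
    n * meanAffinity μ Θ b < Real.log n ^ (-1 : ℝ)) h0 h1 hΘ
    (Real.rpow_nonneg hlog.le (-1 : ℝ)) hε hn hεn fun b hb => hb.le
  simpa only [not_lt] using this

theorem goodProb_sub {l : ℕ} {p p' : (Fin l → Fin 2) → Prop} (h : ∀ b, p b → p' b) :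
    goodProb μ (fun b => ¬ p b ∧ p' b) = goodProb μ p' - goodProb μ p := by
  unfold goodProb
  rw [← Finset.sum_sub_distrib]
  refine Finset.sum_congr rfl fun b _ => ?_
  by_cases hp : p b
  · simp [hp, h b hp]
  · by_cases hp' : p' b <;> simp [hp, hp']

theorem tendsto_exp_sub_sq {c : ℝ} (hc : 0 < c) :
    Tendsto (fun n : ℕ => Real.exp (Real.log n - c * Real.log n ^ 2)) atTop (𝓝 0) := by
  refine Real.tendsto_exp_atBot.comp ?_
  have h1 : Tendsto (fun x : ℝ => 1 - c * x) atTop atBot :=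
    tendsto_atBot_add_const_left _ 1 (tendsto_id.const_mul_atTop_of_neg (neg_lt_zero.mpr hc))
      |>.congr fun x => by simp only [id]; ring
  refine ((tendsto_id.atTop_mul_atBot₀ h1).comp tendsto_log_natCast_atTop).congr fun n => ?_
  simp only [Function.comp_apply, id]
  ring

theorem one_sub_pow_le_exp {x y : ℝ} {m : ℕ} (hx : x ≤ 1) (h : y ≤ x * m) :
    (1 - x) ^ m ≤ Real.exp (-y) := by
  have h1 : 1 - x ≤ Real.exp (-x) := by
    have := Real.add_one_le_exp (-x)
    linarith
  refine (pow_le_pow_left₀ (by linarith) h1 m).trans ?_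
  rw [← Real.exp_nat_mul]
  exact Real.exp_le_exp.mpr (by linarith)

theorem disconnection_bound {n : ℕ} (hn : 6 ≤ n) {g g₀ L : ℝ} (hg₀ : 0 < g₀) (hg : g₀ ≤ g)
    (hg1 : g ≤ 1) (hδ1 : L ^ 2 / n ≤ 1) :
    3 * ((1 - L ^ 2 / n * g / 8) ^ (n / 3) * n + 2 / g * (1 - g * (L ^ 2 / n)) ^ (n / 3)) ≤
      3 * (1 + 2 / g₀) * (n * Real.exp (-(g₀ / 48 * L ^ 2))) := by
  have hn' : (0 : ℝ) < n := by
    have : 0 < n := by omega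
    exact_mod_cast this
  have hn1 : (1 : ℝ) ≤ n := by
    have : 1 ≤ n := by omega
    exact_mod_cast this
  -- Rounding down costs at most a factor 2 here; with the 8 of the drift bound this gives the
  -- constant 48.
  have hm : (n : ℝ) ≤ 6 * ((n / 3 : ℕ) : ℝ) := by
    have : n ≤ 6 * (n / 3) := by omega
    exact_mod_cast this
  have hg0 : 0 < g := hg₀.trans_le hg
  have hδ0 : 0 ≤ L ^ 2 / n := by positivity
  have hδg1 : L ^ 2 / n * g ≤ 1 := mul_le_one₀ hδ1 hg0.le hg1
  have hδm : L ^ 2 ≤ 6 * (L ^ 2 / n * ((n / 3 : ℕ) : ℝ)) := by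
    have h2 := mul_le_mul_of_nonneg_left hm hδ0
    rw [div_mul_cancel₀ _ hn'.ne'] at h2
    linarith
  have hδm0 : 0 ≤ L ^ 2 / n * ((n / 3 : ℕ) : ℝ) := by positivity
  have hkey : g₀ * L ^ 2 ≤ 6 * (g * (L ^ 2 / n * ((n / 3 : ℕ) : ℝ))) := by
    calc g₀ * L ^ 2 ≤ g * L ^ 2 := mul_le_mul_of_nonneg_right hg (sq_nonneg L)
      _ ≤ g * (6 * (L ^ 2 / n * ((n / 3 : ℕ) : ℝ))) := mul_le_mul_of_nonneg_left hδm hg0.le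
      _ = _ := by ring
  have hkey0 : 0 ≤ g * (L ^ 2 / n * ((n / 3 : ℕ) : ℝ)) := mul_nonneg hg0.le hδm0
  have e1 : (1 - L ^ 2 / n * g / 8) ^ (n / 3) ≤ Real.exp (-(g₀ / 48 * L ^ 2)) :=
    one_sub_pow_le_exp (by linarith) (by linarith)
  have e2 : (1 - g * (L ^ 2 / n)) ^ (n / 3) ≤ Real.exp (-(g₀ / 48 * L ^ 2)) :=
    one_sub_pow_le_exp (by linarith) (by linarith)
  have e3 : Real.exp (-(g₀ / 48 * L ^ 2)) ≤ n * Real.exp (-(g₀ / 48 * L ^ 2)) :=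
    le_mul_of_one_le_left (Real.exp_nonneg _) hn1
  have e4 : 2 / g * (1 - g * (L ^ 2 / n)) ^ (n / 3) ≤
      2 / g₀ * (n * Real.exp (-(g₀ / 48 * L ^ 2))) :=
    mul_le_mul (div_le_div_of_nonneg_left zero_le_two hg₀ hg) (e2.trans e3)
      (pow_nonneg (by linarith) _) (by positivity)
  have e5 := mul_le_mul_of_nonneg_right e1 hn'.le
  linarith

theorem few_good_bound {n : ℕ} {g g₀ : ℝ} (hg₀ : 0 < g₀) (hg : g₀ ≤ g) (hg1 : g ≤ 1) :
    ((2 : ℝ) ^ (g₀ / 2) * (1 - g / 2)) ^ n ≤ (1 - g₀ ^ 2 / 4) ^ n := by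
  -- Bernoulli's inequality `2 ^ (g₀ / 2) ≤ 1 + g₀ / 2`, which makes the product at most `1 - g₀² /
  -- 4`.
  have h1 := rpow_one_add_le_one_add_mul_self (s := 1) (p := g₀ / 2) (by norm_num)
    (by linarith) (by linarith)
  norm_num at h1
  have h2 : (0 : ℝ) < (2 : ℝ) ^ (g₀ / 2) := Real.rpow_pos_of_pos two_pos _
  refine pow_le_pow_left₀ (mul_nonneg h2.le (by linarith)) ?_ n
  calc (2 : ℝ) ^ (g₀ / 2) * (1 - g / 2) ≤ (1 + g₀ / 2) * (1 - g₀ / 2) :=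
        mul_le_mul h1 (by linarith) (by linarith) (by linarith)
    _ = _ := by ring

/-- The same limit for every `k` is what matters: the exponents `2` and `-1` define good and bad
nodes, and the nodes in between have proportion tending to `q - q = 0`. -/
theorem uniqueGiantWHP_of_tendsto (h0 : 0 ≤ μ) (h1 : μ ≤ 1) (hΘ : IsAffinity Θ) {q : ℝ}
    (hq : 0 < q) (h : ∀ k : ℝ, Tendsto (fun n : ℕ => goodProb μ fun b : Fin (l n) → Fin 2 =>
      Real.log n ^ k ≤ n * meanAffinity μ Θ b) atTop (𝓝 q)) : UniqueGiantWHP l μ Θ := by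
  have hL := tendsto_log_natCast_atTop
  -- Half the limiting proportion is an eventual lower bound for the proportion of good nodes; the
  -- giant gets size `g₀ / 2 * n`, independent of `ε`.
  set g₀ := q / 2 with hg₀
  have hg₀0 : 0 < g₀ := half_pos hq
  refine ⟨g₀ / 2, half_pos hg₀0, fun ε hε => ?_⟩
  have hη : Tendsto (fun n : ℕ => Real.log n ^ (-1 : ℝ)) atTop (𝓝 0) :=
    (tendsto_rpow_neg_atTop one_pos).comp hL
  have hg := (h 2).eventually_const_lt (half_lt_self hq)
  obtain ⟨n₀, hn₀⟩ := hg.exists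
  have hg₀1 : g₀ ≤ 1 := hn₀.le.trans (goodProb_le_one h0 h1 _)
  have hpow : Tendsto (fun n : ℕ => (1 - g₀ ^ 2 / 4) ^ n) atTop (𝓝 0) := by
    refine tendsto_pow_atTop_nhds_zero_of_lt_one ?_ ?_
    · have := pow_le_one₀ (n := 2) hg₀0.le hg₀1
      linarith
    · have := pow_pos hg₀0 2
      linarith
  have hlow : Tendsto (fun n : ℕ => 1 - (3 * (1 + 2 / g₀) *
      Real.exp (Real.log n - g₀ / 48 * Real.log n ^ 2) + ((1 - g₀ ^ 2 / 4) ^ n +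
        ((goodProb μ (fun b : Fin (l n) → Fin 2 =>
          Real.log n ^ (-1 : ℝ) ≤ n * meanAffinity μ Θ b) -
          goodProb μ (fun b : Fin (l n) → Fin 2 =>
          Real.log n ^ (2 : ℝ) ≤ n * meanAffinity μ Θ b)) + Real.log n ^ (-1 : ℝ)) / ε)))
      atTop (𝓝 1) := by
    have h3 := (tendsto_exp_sub_sq (c := g₀ / 48) (by positivity)).const_mul (3 * (1 + 2 / g₀))
    simpa using (h3.add (hpow.add ((((h (-1)).sub (h 2)).add hη).div_const ε))).const_sub 1
  have hδ : ∀ᶠ n : ℕ in atTop, Real.log n ^ 2 / (n : ℝ) ≤ 1 := by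
    have h4 := (Real.isLittleO_pow_log_id_atTop (n := 2)).tendsto_div_nhds_zero.comp
      (tendsto_natCast_atTop_atTop (R := ℝ))
    exact (h4.eventually_lt_const one_pos).mono fun n hn => le_of_lt hn
  refine tendsto_of_tendsto_of_tendsto_of_le_of_le' hlow tendsto_const_nhds ?_
    (Eventually.of_forall fun n => prob_le_one h0 h1 hΘ _)
  filter_upwards [eventually_ge_atTop 6, hL.eventually_ge_atTop 1, hg, hδ,
    (tendsto_natCast_atTop_atTop.const_mul_atTop hε).eventually_ge_atTop 1]
    with n hn hlog hgn hδn hεn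
  have hn0 : 0 < n := by omega
  have hn' : (0 : ℝ) < n := by exact_mod_cast hn0
  have hlog0 : 0 < Real.log n := by linarith
  have hmain := one_sub_le_prob_unique_giant (n := n) (δ := Real.log n ^ 2 / n)
    (good := fun b : Fin (l n) → Fin 2 => Real.log n ^ (2 : ℝ) ≤ n * meanAffinity μ Θ b)
    (bad := fun b : Fin (l n) → Fin 2 => n * meanAffinity μ Θ b < Real.log n ^ (-1 : ℝ))
    h0 h1 hΘ
    (fun b b' hb hb' => hb'.trans
      (mul_le_mul_of_nonneg_left (hΘ.meanAffinity_anti h0 h1 hb) hn'.le))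
    (by positivity) hδn
    (fun b hb => by
      rw [Real.rpow_two] at hb
      rwa [div_le_iff₀ hn', mul_comm])
    (hg₀0.trans hgn) (Real.rpow_nonneg hlog0.le (-1 : ℝ)) hε (half_pos hg₀0).le hn0 hεn
    fun b hb => hb.le
  refine le_trans (sub_le_sub_left ?_ 1) hmain
  refine add_le_add ?_ (add_le_add ?_ ?_)
  · refine (disconnection_bound hn hg₀0 hgn.le (goodProb_le_one h0 h1 _) hδn).trans (le_of_eq ?_)
    rw [Real.exp_sub, Real.exp_log hn', Real.exp_neg]
    ring
  · exact few_good_bound hg₀0 hgn.le (goodProb_le_one h0 h1 _)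
  · refine div_le_div_of_nonneg_right (add_le_add (le_of_eq ?_) le_rfl) hε.le
    rw [← goodProb_sub]
    · simp only [not_lt]
    · intro b hb
      refine le_trans ?_ hb
      exact Real.rpow_le_rpow_of_exponent_le hlog (by norm_num)

theorem isAffinity_of_lt {α β γ : ℝ} (hγ : 0 < γ) (hγβ : γ < β) (hβα : β < α) (hα : α < 1) :
    IsAffinity !![α, β; β, γ] := by
  refine ⟨fun i j => ?_, fun i j => ?_, fun i j => ?_, fun i j j' hj => ?_⟩
  · fin_cases i <;> fin_cases j <;> simp <;> linarith
  · fin_cases i <;> fin_cases j <;> simp <;> linarith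
  · fin_cases i <;> fin_cases j <;> simp
  · fin_cases i <;> fin_cases j <;> fin_cases j' <;> simp at hj ⊢ <;> linarith

end Main

end MAG

/-! ### The transition at `q = 1/2`. -/

theorem theorem4p1 (μ α β γ ρ : ℝ) (hμ0 : 0 < μ) (hμ1 : μ < 1)
    (hγ : 0 < γ) (hγβ : γ < β) (hβα : β < α) (hα : α < 1) (hρ : 0 < ρ)
    (l : ℕ → ℕ) (hl : ∀ n : ℕ, 1 ≤ n → |(l n : ℝ) - ρ * Real.logb 2 n| < 1) :
    (MAG.UniqueGiantWHP l μ !![α, β; β, γ] ↔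
      ((μ * α + (1 - μ) * β) ^ μ * (μ * β + (1 - μ) * γ) ^ (1 - μ)) ^ ρ ≥ 1 / 2) ∧
    (((μ * α + (1 - μ) * β) ^ μ * (μ * β + (1 - μ) * γ) ^ (1 - μ)) ^ ρ < 1 / 2 →
      MAG.NoGiantWHP l μ !![α, β; β, γ]) := by
  have hμ' : 0 < 1 - μ := sub_pos.mpr hμ1
  have hβ : 0 < β := hγ.trans hγβ
  have hB : 0 < μ * β + (1 - μ) * γ := add_pos (mul_pos hμ0 hβ) (mul_pos hμ' hγ)
  have hBA : μ * β + (1 - μ) * γ < μ * α + (1 - μ) * β :=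
    add_lt_add (mul_lt_mul_of_pos_left hβα hμ0) (mul_lt_mul_of_pos_left hγβ hμ')
  have hΘ := MAG.isAffinity_of_lt hγ hγβ hβα hα
  have hlim := MAG.tendsto_goodProb_threshold (Θ := !![α, β; β, γ]) hμ0 hμ1 hB hBA
    (by simp) (by simp) hρ hl
  set A := μ * α + (1 - μ) * β
  set B := μ * β + (1 - μ) * γ
  have hq : (A ^ μ * B ^ (1 - μ)) ^ ρ =
      Real.exp (ρ * (μ * Real.log A + (1 - μ) * Real.log B)) := by
    rw [Real.rpow_def_of_pos (hB.trans hBA), Real.rpow_def_of_pos hB, ← Real.exp_add,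
      ← Real.exp_mul]
    congr 1
    ring
  set x := ρ * (μ * Real.log A + (1 - μ) * Real.log B)
  have hlog2 : 0 < Real.log 2 := Real.log_pos one_lt_two
  have hhalf : (1 / 2 : ℝ) = Real.exp (-Real.log 2) := by
    rw [Real.exp_neg, Real.exp_log two_pos, one_div]
  -- As `q = exp x`, the condition `q < 1/2` reads `x < -log 2`, that is, the growth exponent of the
  -- typical expected degree is negative.
  have hκ : (A ^ μ * B ^ (1 - μ)) ^ ρ < 1 / 2 ↔ 1 + x / Real.log 2 < 0 := by
    rw [hq, hhalf, Real.exp_lt_exp, ← lt_neg_iff_add_neg', div_lt_iff₀ hlog2]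
    constructor <;> intro h <;> linarith
  have hno : (A ^ μ * B ^ (1 - μ)) ^ ρ < 1 / 2 → MAG.NoGiantWHP l μ !![α, β; β, γ] := by
    intro h
    have h2 := hlim (-1)
    rw [MAG.limitTail_of_neg (hκ.mp h)] at h2
    exact MAG.noGiantWHP_of_tendsto hμ0.le hμ1.le hΘ h2
  refine ⟨⟨fun h => ?_, fun h => ?_⟩, hno⟩
  · by_contra hlt
    exact MAG.not_uniqueGiantWHP_of_noGiantWHP hμ0.le hμ1.le hΘ (hno (not_le.mp hlt)) h
  · refine MAG.uniqueGiantWHP_of_tendsto hμ0.le hμ1.le hΘ (MAG.limitTail_pos ?_) hlim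
    exact not_lt.mp fun h' => not_lt.mpr h (hκ.mpr h')
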